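/- Let $d$ be a natural number, let $(\Omega,\mathcal M,\mathbb P)$ be a probability space, and let $\mathcal H$ be $l^2(\mathbb Z^d)$ (discrete model) or $L^2(\mathbb R^d)$ (continuous model). For $i\in\mathbb Z^d$ let $U_i$ be the unitary operator $(U_i\varphi)(x)=\varphi(x-i)$ on $\mathcal H$. Let $\{H_\omega\}_{\omega\in\Omega}$ be a $\mathbb Z^d$-stationary family of (possibly unbounded) self-adjoint operators on $\mathcal H$. This means that - the family is measurable: for every $z\in\mathbb C\setminus\mathbb R$ and all $x,y\in\mathcal H$ the function $\omega\mapsto\langle x,(H_\omega-z)^{-1}y\rangle$ is measurable; - there are measurable maps $T_i:\Omega\to\Omega$, $i\in\mathbb Z^d$, preserving $\mathbb P$, with $H_{T_i\omega}=U_iH_\omega U_i^*$ for all $i\in\mathbb Z^d$ and $\omega\in\Omega$. A closed subspace $M\subset\mathcal H$ with orthogonal projection $P_M$ reduces $H_\omega$ if $u\in D(H_\omega)$ implies $P_Mu\in D(H_\omega)$ and $H_\omega P_Mu\in M$; then $H_\omega|_M$ denotes the operator in the Hilbert space $M$ with domain $M\cap D(H_\omega)$ which acts there as $H_\omega$. A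 set $\Sigma\subset\mathbb R$ is a $\mathbb P$-positive spectrum for $\{H_\omega\}$ if there are closed subspaces $M_\omega$ reducing $H_\omega$ $(\omega\in\Omega)$ and a measurable set $\Omega_\Sigma\subset\Omega$ with $\mathbb P(\Omega_\Sigma)>0$ such that $\Sigma=\sigma(H_\omega|_{M_\omega})$ for all $\omega\in\Omega_\Sigma$. Let $E_{H_\omega}$ be the projection-valued spectral measure of $H_\omega$. The density of states measure $\nu$ is defined for Borel sets $A\subset\mathbb R$ by $$\nu(A)=\mathbb E\bigl(\langle\delta_0,E_{H_\omega}(A)\delta_0\rangle\bigr)\quad\text{(discrete model)},\qquad \nu(A)=\mathbb E\bigl(\operatorname{tr}\,\chi_\Lambda E_{H_\omega}(A)\chi_\Lambda\bigr)\quad\text{(continuous model)},$$ where $\mathbb E$ is the expectation with respect to $\mathbb P$, $\delta_0(0)=1$ and $\delta_0(n)=0$ for $n\ne0$, $\Lambda=[-1/2,1/2]^d$, and $\chi_\Lambda$ acts by multiplication; values in $[0,\infty]$ are allowed. Let $I\subset\mathbb R$ be a closed interval, possibly unbounded, with interior $I^\circ$, and let $\Sigma$ be a $\mathbb P$-positive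 spectrum for $\{H_\omega\}_{\omega\in\Omega}$. Then, in both models, $$\nu(\Sigma\cap I)=0\quad\text{implies}\quad\Sigma\cap I^\circ=\emptyset .$$ -/

import Mathlib

open MeasureTheory
open scoped ENNReal

namespace RandomOperator

noncomputable section

/-! ## Unbounded operators on a complex Hilbert space -/

section Operators

variable {𝓗 : Type*} [NormedAddCommGroup 𝓗] [InnerProductSpace ℂ 𝓗]

/-- `R` is the bounded two-sided inverse of `A - z : D(A) → 𝓗`. -/
structure IsResolventAt (A : 𝓗 →ₗ.[ℂ] 𝓗) (z : ℂ) (R : 𝓗 →L[ℂ] 𝓗) : Prop where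
  mem_domain : ∀ x, R x ∈ A.domain
  right_inv : ∀ x, A ⟨R x, mem_domain x⟩ - z • R x = x
  left_inv : ∀ x : A.domain, R (A x - z • (x : 𝓗)) = x

/-- The spectrum of an operator: all `z` for which `A - z` has no bounded inverse. -/
def spec (A : 𝓗 →ₗ.[ℂ] 𝓗) : Set ℂ := {z | ¬ ∃ R, IsResolventAt A z R}

open scoped Classical in
/-- The resolvent `(A - z)⁻¹` (with value `0` if `z` lies in the spectrum). -/
def resolventOp (A : 𝓗 →ₗ.[ℂ] 𝓗) (z : ℂ) : 𝓗 →L[ℂ] 𝓗 :=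
  if h : ∃ R, IsResolventAt A z R then h.choose else 0

/-- The operator `U A U*` with domain `U D(A)`, for a unitary `U`. -/
def unitaryConj (U : 𝓗 ≃ₗᵢ[ℂ] 𝓗) (A : 𝓗 →ₗ.[ℂ] 𝓗) : 𝓗 →ₗ.[ℂ] 𝓗 where
  domain := A.domain.comap (U.symm : 𝓗 →ₗ[ℂ] 𝓗)
  toFun :=
    { toFun := fun x => U (A ⟨U.symm x, x.2⟩)
      map_add' := fun x y => by
        rw [← map_add, ← A.map_add]
        congr 2
        exact Subtype.ext (map_add U.symm (x : 𝓗) y)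
      map_smul' := fun c x => by
        rw [RingHom.id_apply, ← map_smul, ← A.map_smul]
        congr 2
        exact Subtype.ext (map_smul U.symm c (x : 𝓗)) }

variable [CompleteSpace 𝓗]

/-- The closed subspace `M` reduces `A`: if `u ∈ D(A)` then `P_M u ∈ D(A)` and `A P_M u ∈ M`,
where `P_M` is the orthogonal projection onto `M`. -/
def Reduces (M : ClosedSubmodule ℂ 𝓗) (A : 𝓗 →ₗ.[ℂ] 𝓗) : Prop :=
  ∀ u ∈ A.domain, ∃ h : M.toSubmodule.starProjection u ∈ A.domain,
    A ⟨M.toSubmodule.starProjection u, h⟩ ∈ M.toSubmodule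

theorem Reduces.apply_mem {M : ClosedSubmodule ℂ 𝓗} {A : 𝓗 →ₗ.[ℂ] 𝓗} (hM : Reduces M A)
    (u : A.domain) (hu : (u : 𝓗) ∈ M.toSubmodule) : A u ∈ M.toSubmodule := by
  obtain ⟨h, h'⟩ := hM u u.2
  have e : (⟨M.toSubmodule.starProjection u, h⟩ : A.domain) = u :=
    Subtype.ext (Submodule.starProjection_eq_self_iff.2 hu)
  rwa [e] at h'

/-- The restriction `A|_M` to a reducing subspace, as an operator in the Hilbert space `M`:
its domain is `M ∩ D(A)`, and there it acts as `A`. -/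
def restrict (A : 𝓗 →ₗ.[ℂ] 𝓗) (M : ClosedSubmodule ℂ 𝓗) (hM : Reduces M A) :
    M.toSubmodule →ₗ.[ℂ] M.toSubmodule where
  domain := A.domain.comap M.toSubmodule.subtype
  toFun :=
    { toFun := fun f => ⟨A ⟨f, f.2⟩, hM.apply_mem ⟨f, f.2⟩ (f : M.toSubmodule).2⟩
      map_add' := fun f g => Subtype.ext (A.map_add ⟨f, f.2⟩ ⟨g, g.2⟩)
      map_smul' := fun c f => Subtype.ext (A.map_smul c ⟨f, f.2⟩) }

end Operators

/-! ## Projection-valued measures and the spectral projections of a self-adjoint operator -/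

section Spectral

variable (𝓗 : Type*) [NormedAddCommGroup 𝓗] [InnerProductSpace ℂ 𝓗] [CompleteSpace 𝓗]

/-- A projection-valued measure on the Borel sets of `ℝ`: orthogonal projections `E(B)` with
`E(ℝ) = 1` which are countably additive in the strong operator topology. -/
structure PVMeasure where
  proj : Set ℝ → 𝓗 →L[ℂ] 𝓗
  isStarProjection : ∀ B, MeasurableSet B → IsStarProjection (proj B)
  univ : proj Set.univ = 1
  hasSum_iUnion : ∀ B : ℕ → Set ℝ, (∀ n, MeasurableSet (B n)) →
    Pairwise (fun m n => Disjoint (B m) (B n)) →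
    ∀ x, HasSum (fun n => proj (B n) x) (proj (⋃ n, B n) x)

variable {𝓗}

theorem PVMeasure.empty (E : PVMeasure 𝓗) (x : 𝓗) : E.proj ∅ x = 0 := by
  have h := (E.hasSum_iUnion (fun _ => ∅) (fun _ => MeasurableSet.empty)
    (fun _ _ _ => disjoint_bot_left) x).summable
  simpa [summable_const_iff] using h

theorem PVMeasure.re_inner_nonneg (E : PVMeasure 𝓗) {B : Set ℝ} (hB : MeasurableSet B) (x : 𝓗) :
    0 ≤ (inner ℂ x (E.proj B x)).re := by
  have h := E.isStarProjection B hB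
  have h1 : E.proj B x = E.proj B (E.proj B x) := by
    conv_lhs => rw [← h.isIdempotentElem.eq]
    rfl
  have h2 : ContinuousLinearMap.adjoint (E.proj B) = E.proj B := h.isSelfAdjoint.star_eq
  rw [h1, ← ContinuousLinearMap.adjoint_inner_left, h2]
  exact inner_self_nonneg (𝕜 := ℂ)

/-- The finite Borel measure `B ↦ ⟨x, E(B) x⟩`. -/
def PVMeasure.scalarMeasure (E : PVMeasure 𝓗) (x : 𝓗) : Measure ℝ :=
  Measure.ofMeasurable (fun B _ => ENNReal.ofReal (inner ℂ x (E.proj B x)).re)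
    (by simp [E.empty])
    (by
      intro B hB hd
      have h := (Complex.hasSum_re
        ((E.hasSum_iUnion B hB hd x).mapL (innerSL ℂ x)))
      simp only [innerSL_apply_apply] at h
      rw [← h.tsum_eq, ENNReal.ofReal_tsum_of_nonneg
        (fun n => E.re_inner_nonneg (hB n) x) h.summable])

/-- `E` is the spectral measure of `A`, i.e. `A = ∫ t dE(t)`: the domain of `A` consists of the `x`
with `∫ t² d⟨x, E(t) x⟩ < ∞`, and `⟨x, A x⟩ = ∫ t d⟨x, E(t) x⟩` for such `x` (by polarization this
determines `⟨v, A x⟩` for all `v`, `x` in the domain). -/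
structure IsSpectralMeasure (A : 𝓗 →ₗ.[ℂ] 𝓗) (E : PVMeasure 𝓗) : Prop where
  mem_domain_iff : ∀ x, x ∈ A.domain ↔ ∫⁻ t, ENNReal.ofReal (t ^ 2) ∂(E.scalarMeasure x) < ∞
  inner_apply : ∀ x : A.domain,
    inner ℂ (x : 𝓗) (A x) = ((∫ t, t ∂(E.scalarMeasure (x : 𝓗)) : ℝ) : ℂ)

open scoped Classical in
/-- The spectral projection `E_A(B) = χ_B(A)`. By the spectral theorem, a self-adjoint `A` has
exactly one spectral measure (on Borel sets); the value `0` is only used for operators without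
spectral measure, which are not self-adjoint. -/
def spectralProj (A : 𝓗 →ₗ.[ℂ] 𝓗) (B : Set ℝ) : 𝓗 →L[ℂ] 𝓗 :=
  if h : ∃ E, IsSpectralMeasure A E then h.choose.proj B else 0

/-- The trace `∑ ⟨φ, B φ⟩ ∈ [0, ∞]` of a positive bounded operator, over an orthonormal basis
(the sum does not depend on the basis). -/
def posTrace (B : 𝓗 →L[ℂ] 𝓗) : ℝ≥0∞ :=
  ∑' φ : (exists_hilbertBasis ℂ 𝓗).choose,
    ENNReal.ofReal (inner ℂ (φ : 𝓗) (B φ)).re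

end Spectral

/-! ## Random operators -/

section Random

variable {𝓗 : Type*} [NormedAddCommGroup 𝓗] [InnerProductSpace ℂ 𝓗] [CompleteSpace 𝓗]
  {Ω : Type*} [MeasurableSpace Ω] {d : ℕ}

/-- A measurable family of self-adjoint operators: all resolvents at nonreal points are
weakly measurable. -/
structure IsMeasurableFamily (H : Ω → 𝓗 →ₗ.[ℂ] 𝓗) : Prop where
  isSelfAdjoint : ∀ ω, IsSelfAdjoint (H ω)
  measurable_resolvent : ∀ z : ℂ, z.im ≠ 0 → ∀ x y : 𝓗,
    Measurable fun ω => inner ℂ x (resolventOp (H ω) z y)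

/-- The family `H` is `ℤ^d`-stationary with respect to the transformations `T i` of the
probability space and the unitary operators `U i`. -/
structure IsStationaryFamily (P : Measure Ω) (T : (Fin d → ℤ) → Ω → Ω)
    (U : (Fin d → ℤ) → 𝓗 ≃ₗᵢ[ℂ] 𝓗) (H : Ω → 𝓗 →ₗ.[ℂ] 𝓗) : Prop where
  isMeasurableFamily : IsMeasurableFamily H
  measurePreserving : ∀ i, MeasurePreserving (T i) P P
  covariant : ∀ i ω, H (T i ω) = unitaryConj (U i) (H ω)

/-- `S` is a `P`-positive spectrum of the family `H`: there are closed subspaces `M ω` reducing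
`H ω` such that `S = σ(H ω |_{M ω})` for all `ω` in a set of positive probability. -/
def IsPositiveSpectrum (P : Measure Ω) (H : Ω → 𝓗 →ₗ.[ℂ] 𝓗) (S : Set ℝ) : Prop :=
  ∃ (M : Ω → ClosedSubmodule ℂ 𝓗) (hM : ∀ ω, Reduces (M ω) (H ω)) (Ω₀ : Set Ω),
    MeasurableSet Ω₀ ∧ 0 < P Ω₀ ∧
      ∀ ω ∈ Ω₀, spec (restrict (H ω) (M ω) (hM ω)) = Complex.ofReal '' S

end Random

/-! ## The discrete model `l²(ℤ^d)` -/

section Discrete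

variable (d : ℕ)

/-- The Hilbert space `l²(ℤ^d)`. -/
abbrev DiscreteSpace : Type := lp (fun _ : Fin d → ℤ => ℂ) 2

variable {d}

theorem memlp_shift (i : Fin d → ℤ) (f : DiscreteSpace d) :
    Memℓp (fun x : Fin d → ℤ => f (x - i)) 2 := by
  have h := lp.memℓp f
  rw [memℓp_gen_iff (by norm_num)] at h ⊢
  exact ((Equiv.subRight i).summable_iff
    (f := fun x => ‖f x‖ ^ (2 : ℝ≥0∞).toReal)).2 h

/-- The unitary translation `(U_i φ)(x) = φ(x - i)` on `l²(ℤ^d)`. -/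
def discreteShift (i : Fin d → ℤ) : DiscreteSpace d ≃ₗᵢ[ℂ] DiscreteSpace d where
  toFun f := ⟨fun x => f (x - i), memlp_shift i f⟩
  invFun f := ⟨fun x => f (x - -i), memlp_shift (-i) f⟩
  map_add' f g := rfl
  map_smul' c f := rfl
  left_inv f := by
    ext x
    exact congrArg (f : (Fin d → ℤ) → ℂ) (by abel : x - -i - i = x)
  right_inv f := by
    ext x
    exact congrArg (f : (Fin d → ℤ) → ℂ) (by abel : x - i - -i = x)
  norm_map' f := by
    change ‖(⟨fun x => f (x - i), memlp_shift i f⟩ : DiscreteSpace d)‖ = ‖f‖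
    rw [lp.norm_eq_tsum_rpow (by norm_num), lp.norm_eq_tsum_rpow (by norm_num)]
    congr 1
    exact (Equiv.subRight i).tsum_eq fun x => ‖f x‖ ^ (2 : ℝ≥0∞).toReal

/-- The density of states `ν(B) = 𝔼 ⟨δ₀, E_{H_ω}(B) δ₀⟩` in the discrete model, `B` Borel. -/
def discreteDOS {Ω : Type*} [MeasurableSpace Ω] (P : Measure Ω)
    (H : Ω → DiscreteSpace d →ₗ.[ℂ] DiscreteSpace d) (B : Set ℝ) : ℝ≥0∞ :=
  ∫⁻ ω, ENNReal.ofReal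
    (inner ℂ (lp.single 2 0 1 : DiscreteSpace d)
      (spectralProj (H ω) B (lp.single 2 0 1 : DiscreteSpace d))).re ∂P

end Discrete

/-! ## The continuous model `L²(ℝ^d)` -/

section Continuous

variable (d : ℕ)

/-- The Hilbert space `L²(ℝ^d)` with respect to Lebesgue measure. -/
abbrev ContinuousSpace : Type := Lp ℂ 2 (volume : Measure (Fin d → ℝ))

variable {d}

/-- The translation `x ↦ x - i` of `ℝ^d`. -/
def subLattice (i : Fin d → ℤ) (x : Fin d → ℝ) : Fin d → ℝ := x - fun k => (i k : ℝ)

theorem measurePreserving_subLattice (i : Fin d → ℤ) :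
    MeasurePreserving (subLattice i) (volume : Measure (Fin d → ℝ)) volume :=
  measurePreserving_sub_right volume _

theorem shift_shift (i j : Fin d → ℤ) (hij : i + j = 0) (f : ContinuousSpace d) :
    Lp.compMeasurePreserving (subLattice i) (measurePreserving_subLattice i)
      (Lp.compMeasurePreserving (subLattice j) (measurePreserving_subLattice j) f) = f := by
  rw [← Lp.compMeasurePreserving_comp_apply]
  have h : subLattice j ∘ subLattice i = id := by
    funext x k
    have := congrFun hij k
    have h' : (i k : ℝ) + j k = 0 := by exact_mod_cast this
    simp only [subLattice, Function.comp_apply, Pi.sub_apply, id]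
    linarith
  simp only [h]
  exact Lp.compMeasurePreserving_id_apply f

/-- The unitary translation `(U_i φ)(x) = φ(x - i)` on `L²(ℝ^d)`. -/
def continuousShift (i : Fin d → ℤ) : ContinuousSpace d ≃ₗᵢ[ℂ] ContinuousSpace d where
  toLinearEquiv := LinearEquiv.ofLinearMap
    (Lp.compMeasurePreservingₗ ℂ (subLattice i) (measurePreserving_subLattice i))
    (Lp.compMeasurePreservingₗ ℂ (subLattice (-i)) (measurePreserving_subLattice (-i)))
    (LinearMap.ext fun f => shift_shift i (-i) (by simp) f)
    (LinearMap.ext fun f => shift_shift (-i) i (by simp) f)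
  norm_map' f := Lp.norm_compMeasurePreserving f (measurePreserving_subLattice i)

theorem continuousShift_coeFn (i : Fin d → ℤ) (f : ContinuousSpace d) :
    continuousShift i f =ᵐ[volume] fun x => f (x - fun k => (i k : ℝ)) :=
  Lp.coeFn_compMeasurePreserving f (measurePreserving_subLattice i)

/-- The unit cube `Λ = [-1/2, 1/2]^d`. -/
def unitCube (d : ℕ) : Set (Fin d → ℝ) := Set.Icc (fun _ => -(1 / 2)) (fun _ => 1 / 2)

/-- Multiplication by the characteristic function of `Λ` on `L²(ℝ^d)`. -/
def cubeMul (d : ℕ) : ContinuousSpace d →L[ℂ] ContinuousSpace d :=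
  (ContinuousLinearMap.lsmul ℂ ℂ).holderL volume ∞ 2 2
    (indicatorConstLp ∞ (measurableSet_Icc : MeasurableSet (unitCube d))
      isCompact_Icc.measure_ne_top (1 : ℂ))

theorem cubeMul_coeFn (f : ContinuousSpace d) :
    cubeMul d f =ᵐ[volume] (unitCube d).indicator f := by
  refine ((ContinuousLinearMap.lsmul ℂ ℂ).coeFn_holder (r := 2)
    (indicatorConstLp ∞ (measurableSet_Icc : MeasurableSet (unitCube d))
      isCompact_Icc.measure_ne_top (1 : ℂ)) f).trans ?_
  filter_upwards [indicatorConstLp_coeFn (p := ∞)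
    (hs := (measurableSet_Icc : MeasurableSet (unitCube d)))
    (hμs := isCompact_Icc.measure_ne_top) (c := (1 : ℂ))] with x hx
  rw [hx]
  change (unitCube d).indicator (fun _ => (1 : ℂ)) x * f x = (unitCube d).indicator f x
  by_cases h : x ∈ unitCube d <;> simp [h]

/-- The density of states `ν(B) = 𝔼 tr(χ_Λ E_{H_ω}(B) χ_Λ)` in the continuous model, `B` Borel. -/
def continuousDOS {Ω : Type*} [MeasurableSpace Ω] (P : Measure Ω)
    (H : Ω → ContinuousSpace d →ₗ.[ℂ] ContinuousSpace d) (B : Set ℝ) : ℝ≥0∞ :=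
  ∫⁻ ω, posTrace (cubeMul d ∘L spectralProj (H ω) B ∘L cubeMul d) ∂P

end Continuous

end

end RandomOperator

open RandomOperator

namespace RandomOperator

noncomputable section

/-! ### Resolvents of an arbitrary operator -/

section Resolvents

variable {𝓗 : Type*} [NormedAddCommGroup 𝓗] [InnerProductSpace ℂ 𝓗]

/-! Write `B = S ∩ I` and let `E_ω` be the spectral measure of `H ω`. In the discrete model `ν(B)`
is the expectation of `‖E_ω(B) δ₀‖²`, so `ν(B) = 0` gives `E_ω(B) δ₀ = 0` almost surely. Covariance
and invariance of `P` carry this to every translate of `δ₀`. There are countably many translates and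
they are total, hence `E_ω(B) = 0` almost surely. In the continuous model the vectors `χ_Λ φ`, with
`φ` in a countable orthonormal basis, play the role of `δ₀`, and the translates of `Λ` cover `ℝ^d`.

Since the positive spectrum is attained with positive probability, some `ω` has both `E_ω(B) = 0`
and `σ(H ω|_M) = S`. The rest is deterministic (`Reduces.inter_interior_eq_empty`). On vectors of
`M` the spectral measure lives on `S`. If `l ∈ S` had a ball of radius `ε` inside `I`, the measure
would vanish on that ball, so the resolvent at `l + iε/2` would have norm at most `1/ε` on `M`. A
Neumann series then reaches `l`, which contradicts `l ∈ S`.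

Most of the work is the spectral theorem, because `spectralProj` is a choice among measures
specified only by domain and quadratic form. Existence (`exists_isSpectralMeasure`) comes from the
continuous functional calculus of the normal operator `(A - i)⁻¹` and the Riesz representation
theorem. Everything else passes through `IsSpectralMeasure.inner_resolvent`: `⟨x, (A - z)⁻¹ x⟩` is
the Stieltjes transform of the scalar measure of `x`. With Stieltjes inversion this gives
independence of the choice, unitary covariance, measurability in `ω` and invariance of reducing
subspaces. -/

theorem IsResolventAt.unique {A : 𝓗 →ₗ.[ℂ] 𝓗} {z : ℂ} {R R' : 𝓗 →L[ℂ] 𝓗}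
    (h : IsResolventAt A z R) (h' : IsResolventAt A z R') : R = R' := by
  ext x
  have h1 := h.left_inv ⟨R' x, h'.mem_domain x⟩
  rw [h'.right_inv x] at h1
  exact h1

theorem IsResolventAt.resolventOp_eq {A : 𝓗 →ₗ.[ℂ] 𝓗} {z : ℂ} {R : 𝓗 →L[ℂ] 𝓗}
    (h : IsResolventAt A z R) : resolventOp A z = R := by
  have h' : ∃ R, IsResolventAt A z R := ⟨R, h⟩
  rw [resolventOp, dif_pos h']
  exact h'.choose_spec.unique h

theorem IsResolventAt.apply_eq {A : 𝓗 →ₗ.[ℂ] 𝓗} {z : ℂ} {R : 𝓗 →L[ℂ] 𝓗}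
    (h : IsResolventAt A z R) (x : 𝓗) : A ⟨R x, h.mem_domain x⟩ = x + z • R x :=
  sub_eq_iff_eq_add.1 (h.right_inv x)

theorem IsResolventAt.injective {A : 𝓗 →ₗ.[ℂ] 𝓗} {z : ℂ} {R : 𝓗 →L[ℂ] 𝓗}
    (h : IsResolventAt A z R) {x : 𝓗} (hx : R x = 0) : x = 0 := by
  have h1 := h.right_inv x
  have h2 : (⟨R x, h.mem_domain x⟩ : A.domain) = 0 := Subtype.ext hx
  rw [h2, hx] at h1
  simpa using h1.symm

/-- The first resolvent identity. -/
theorem IsResolventAt.sub_eq {A : 𝓗 →ₗ.[ℂ] 𝓗} {z w : ℂ} {R R' : 𝓗 →L[ℂ] 𝓗}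
    (h : IsResolventAt A z R) (h' : IsResolventAt A w R') (x : 𝓗) :
    R x - R' x = (z - w) • R (R' x) := by
  have h1 := h.left_inv ⟨R' x, h'.mem_domain x⟩
  rw [h'.apply_eq] at h1
  simp only [map_sub, map_add, map_smul] at h1
  calc R x - R' x = R x - (R x + w • R (R' x) - z • R (R' x)) := by rw [h1]
    _ = (z - w) • R (R' x) := by rw [sub_smul]; abel

/-- Perturbation of the spectral parameter by a Neumann series. -/
theorem IsResolventAt.exists_of_norm_lt [CompleteSpace 𝓗] {A : 𝓗 →ₗ.[ℂ] 𝓗} {z w : ℂ}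
    {R : 𝓗 →L[ℂ] 𝓗} (h : IsResolventAt A z R) (hw : ‖w - z‖ * ‖R‖ < 1) :
    ∃ R', IsResolventAt A w R' := by
  have hn : ‖(w - z) • R‖ < 1 := by rwa [norm_smul]
  set u := Units.oneSub ((w - z) • R) hn with hu
  have hval : (u : 𝓗 →L[ℂ] 𝓗) = 1 - (w - z) • R := rfl
  -- The resolvent at `w` will be `R V`, where `V = (1 - (w - z) R)⁻¹`.
  set V : 𝓗 →L[ℂ] 𝓗 := ((u⁻¹ : (𝓗 →L[ℂ] 𝓗)ˣ) : 𝓗 →L[ℂ] 𝓗) with hV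
  have h1 : ∀ x, V x - (w - z) • R (V x) = x := fun x => by
    have := congrArg (fun T : 𝓗 →L[ℂ] 𝓗 => T x) u.mul_inv
    simpa [hval] using this
  have h2 : ∀ x, V (x - (w - z) • R x) = x := fun x => by
    have := congrArg (fun T : 𝓗 →L[ℂ] 𝓗 => T x) u.inv_mul
    simpa [hval] using this
  have hcomm : ∀ x, R (V x) = V (R x) := fun x => by
    have e : R (V x) - (w - z) • R (R (V x)) = R x := by
      rw [← map_smul, ← map_sub, h1]
    rw [← e, h2]
  refine ⟨R ∘L V, ⟨fun x => h.mem_domain _, fun x => ?_, fun x => ?_⟩⟩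
  · change A ⟨R (V x), _⟩ - w • R (V x) = x
    rw [h.apply_eq]
    calc V x + z • R (V x) - w • R (V x) = V x - (w - z) • R (V x) := by rw [sub_smul]; abel
      _ = x := h1 x
  · change R (V (A x - w • (x : 𝓗))) = x
    have e : A x - w • (x : 𝓗) = (A x - z • (x : 𝓗)) - (w - z) • R (A x - z • (x : 𝓗)) := by
      rw [h.left_inv, sub_smul]
      abel
    rw [e, h2, h.left_inv]

theorem isClosed_spec [CompleteSpace 𝓗] (A : 𝓗 →ₗ.[ℂ] 𝓗) : IsClosed (spec A) := by
  rw [← isOpen_compl_iff, Metric.isOpen_iff]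
  intro z hz
  simp only [spec, Set.mem_compl_iff, Set.mem_ofPred_eq, not_not] at hz
  obtain ⟨R, hR⟩ := hz
  refine ⟨1 / (‖R‖ + 1), by positivity, fun w hw => ?_⟩
  simp only [spec, Set.mem_compl_iff, Set.mem_ofPred_eq, not_not]
  refine hR.exists_of_norm_lt ?_
  rw [Metric.mem_ball, dist_eq_norm] at hw
  calc ‖w - z‖ * ‖R‖ ≤ 1 / (‖R‖ + 1) * ‖R‖ := by gcongr
    _ < 1 := by
      rw [one_div, inv_mul_lt_iff₀ (by positivity)]
      linarith

end Resolvents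

/-! ### Self-adjoint operators: nonreal points lie in the resolvent set -/

section SelfAdjoint

variable {𝓗 : Type*} [NormedAddCommGroup 𝓗] [InnerProductSpace ℂ 𝓗] [CompleteSpace 𝓗]
  {A : 𝓗 →ₗ.[ℂ] 𝓗}

theorem inner_apply_comm (hA : IsSelfAdjoint A) (x y : A.domain) :
    inner ℂ (A x) (y : 𝓗) = inner ℂ (x : 𝓗) (A y) := by
  have h := LinearPMap.adjoint_isFormalAdjoint hA.dense_domain
  rw [LinearPMap.isSelfAdjoint_def.1 hA] at h
  exact h x y

/-- Here self-adjointness is used beyond symmetry: the hypothesis says `y ∈ D(A*)` with `A* y = w`,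
and `A* = A`. -/
theorem exists_mem_domain (hA : IsSelfAdjoint A) {y w : 𝓗}
    (h : ∀ x : A.domain, inner ℂ w (x : 𝓗) = inner ℂ y (A x)) :
    ∃ hy : y ∈ A.domain, A ⟨y, hy⟩ = w := by
  have hy : y ∈ (LinearPMap.adjoint A).domain :=
    LinearPMap.mem_adjoint_domain_of_exists _ ⟨w, h⟩
  have hy' : y ∈ A.domain := by rwa [LinearPMap.isSelfAdjoint_def.1 hA] at hy
  refine ⟨hy', ?_⟩
  have e := LinearPMap.adjoint_apply_eq hA.dense_domain ⟨y, hy⟩ h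
  rw [← e]
  exact (LinearPMap.isSelfAdjoint_def.1 hA).ge.2 rfl

theorem inner_self_apply_im (hA : IsSelfAdjoint A) (x : A.domain) :
    (inner ℂ (x : 𝓗) (A x)).im = 0 := by
  have h := inner_apply_comm hA x x
  rw [← inner_conj_symm] at h
  have := congrArg Complex.im h
  simp only [Complex.conj_im] at this
  linarith

/-- The form `⟨x, A x⟩` is real, so only `-z` contributes. Besides the lower bound for `A - z`, this
shows that a vector orthogonal to its own image under `A - z` is zero when `z` is nonreal. -/
theorem im_inner_sub_smul (hA : IsSelfAdjoint A) (z : ℂ) (x : A.domain) :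
    (inner ℂ (x : 𝓗) (A x - z • (x : 𝓗))).im = -(z.im * ‖(x : 𝓗)‖ ^ 2) := by
  rw [inner_sub_right, Complex.sub_im, inner_self_apply_im hA, inner_smul_right,
    inner_self_eq_norm_sq_to_K]
  simp [← Complex.ofReal_pow, Complex.mul_im]

theorem abs_im_mul_norm_le (hA : IsSelfAdjoint A) (z : ℂ) (x : A.domain) :
    |z.im| * ‖(x : 𝓗)‖ ≤ ‖A x - z • (x : 𝓗)‖ := by
  have h := im_inner_sub_smul hA z x
  have h1 : |z.im| * ‖(x : 𝓗)‖ ^ 2 ≤ ‖(x : 𝓗)‖ * ‖A x - z • (x : 𝓗)‖ := by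
    calc |z.im| * ‖(x : 𝓗)‖ ^ 2 = |(inner ℂ (x : 𝓗) (A x - z • (x : 𝓗))).im| := by
          rw [h, abs_neg, abs_mul, abs_of_nonneg (sq_nonneg ‖(x : 𝓗)‖)]
      _ ≤ ‖inner ℂ (x : 𝓗) (A x - z • (x : 𝓗))‖ := Complex.abs_im_le_norm _
      _ ≤ _ := norm_inner_le_norm _ _
  rcases (norm_nonneg (x : 𝓗)).eq_or_lt with h0 | h0
  · rw [← h0]; simp
  · nlinarith

/-- `A - z` is bounded below, hence injective with closed range since `A` is closed. A vector
orthogonal to the range is an eigenvector candidate of `A` at `conj z`, where the same lower bound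
kills it. -/
theorem exists_isResolventAt (hA : IsSelfAdjoint A) {z : ℂ} (hz : z.im ≠ 0) :
    ∃ R, IsResolventAt A z R := by
  have hz' : 0 < |z.im| := abs_pos.2 hz
  let B : A.domain →ₗ[ℂ] 𝓗 := A.toFun - z • A.domain.subtype
  have hB : ∀ x, B x = A x - z • (x : 𝓗) := fun x => rfl
  have hlow : ∀ x : A.domain, |z.im| * ‖x‖ ≤ ‖B x‖ := fun x => abs_im_mul_norm_le hA z x
  have hinj : Function.Injective B := by
    rw [injective_iff_map_eq_zero]
    intro x hx
    have := hlow x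
    rw [hx, norm_zero] at this
    exact norm_eq_zero.1 (le_antisymm (nonpos_of_mul_nonpos_right this hz') (norm_nonneg x))
  have hclosed : IsClosed (LinearMap.range B : Set 𝓗) := by
    refine isClosed_of_closure_subset fun y hy => ?_
    obtain ⟨s, hs, hlim⟩ := mem_closure_iff_seq_limit.1 hy
    choose u hu using hs
    have hcau : CauchySeq fun n => (u n : 𝓗) := by
      have hs := hlim.cauchySeq
      rw [Metric.cauchySeq_iff] at hs ⊢
      intro ε hε
      obtain ⟨N, hN⟩ := hs (|z.im| * ε) (by positivity)
      refine ⟨N, fun m hm n hn => ?_⟩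
      have h1 := hN m hm n hn
      have h2 := hlow (u m - u n)
      rw [map_sub, hu, hu] at h2
      rw [dist_eq_norm] at h1 ⊢
      have h3 : ‖u m - u n‖ = ‖(u m : 𝓗) - u n‖ := rfl
      rw [h3] at h2
      exact lt_of_mul_lt_mul_left (h2.trans_lt h1) hz'.le
    obtain ⟨v, hv⟩ := cauchySeq_tendsto_of_complete hcau
    have hdom : ∀ x : A.domain, inner ℂ (y + z • v) (x : 𝓗) = inner ℂ v (A x) := by
      intro x
      have l1 : Filter.Tendsto (fun n => inner ℂ (s n + z • (u n : 𝓗)) (x : 𝓗)) Filter.atTop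
          (nhds (inner ℂ (y + z • v) (x : 𝓗))) :=
        (hlim.add (hv.const_smul z)).inner tendsto_const_nhds
      have l2 : Filter.Tendsto (fun n => inner ℂ (u n : 𝓗) (A x)) Filter.atTop
          (nhds (inner ℂ v (A x))) := hv.inner tendsto_const_nhds
      refine tendsto_nhds_unique l1 (l2.congr fun n => ?_)
      rw [← inner_apply_comm hA, ← hu n, hB]
      simp
    obtain ⟨hv', e⟩ := exists_mem_domain hA hdom
    refine ⟨⟨v, hv'⟩, ?_⟩
    rw [hB, e]
    simp
  have htop : LinearMap.range B = ⊤ := by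
    have : CompleteSpace (LinearMap.range B) := hclosed.completeSpace_coe
    rw [← Submodule.orthogonal_eq_bot_iff, Submodule.eq_bot_iff]
    intro v hv
    have hdom : ∀ x : A.domain, inner ℂ ((starRingEnd ℂ) z • v) (x : 𝓗) = inner ℂ v (A x) := by
      intro x
      have := (Submodule.mem_orthogonal' _ _).1 hv (B x) ⟨x, rfl⟩
      rw [hB, inner_sub_right, sub_eq_zero, inner_smul_right] at this
      rw [this, inner_smul_left, RingHomCompTriple.comp_apply, RingHom.id_apply]
    obtain ⟨hv', e⟩ := exists_mem_domain hA hdom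
    have h1 := abs_im_mul_norm_le hA ((starRingEnd ℂ) z) ⟨v, hv'⟩
    rw [e, sub_self, norm_zero, Complex.conj_im, abs_neg] at h1
    exact norm_eq_zero.1 (le_antisymm (nonpos_of_mul_nonpos_right h1 hz') (norm_nonneg v))
  let e := LinearEquiv.ofBijective B ⟨hinj, LinearMap.range_eq_top.1 htop⟩
  have he : ∀ x, B (e.symm x) = x := fun x => e.apply_symm_apply x
  let R : 𝓗 →L[ℂ] 𝓗 := (A.domain.subtype ∘ₗ (e.symm : 𝓗 →ₗ[ℂ] A.domain)).mkContinuous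
    |z.im|⁻¹ fun x => by
      have := hlow (e.symm x)
      rw [he] at this
      rw [inv_mul_eq_div, le_div_iff₀' hz']
      exact this
  refine ⟨R, ⟨fun x => (e.symm x).2, fun x => he x, fun x => ?_⟩⟩
  exact congrArg Subtype.val (e.symm_apply_apply x)

theorem IsResolventAt.norm_le (hA : IsSelfAdjoint A) {z : ℂ} {R : 𝓗 →L[ℂ] 𝓗}
    (h : IsResolventAt A z R) (x : 𝓗) : |z.im| * ‖R x‖ ≤ ‖x‖ := by
  have := abs_im_mul_norm_le hA z ⟨R x, h.mem_domain x⟩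
  rwa [h.right_inv] at this

/-- Reads `‖R x‖` off the imaginary part of a Stieltjes transform; see `norm_resolvent_le_of_null`.
-/
theorem IsResolventAt.im_inner (hA : IsSelfAdjoint A) {z : ℂ} {R : 𝓗 →L[ℂ] 𝓗}
    (h : IsResolventAt A z R) (x : 𝓗) : (inner ℂ x (R x)).im = z.im * ‖R x‖ ^ 2 := by
  have := im_inner_sub_smul hA z ⟨R x, h.mem_domain x⟩
  rw [h.right_inv, ← inner_conj_symm, Complex.conj_im] at this
  linarith

theorem IsResolventAt.adjoint_eq (hA : IsSelfAdjoint A) {z : ℂ} {R R' : 𝓗 →L[ℂ] 𝓗}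
    (h : IsResolventAt A z R) (h' : IsResolventAt A ((starRingEnd ℂ) z) R') : star R = R' := by
  symm
  rw [ContinuousLinearMap.star_eq_adjoint, ContinuousLinearMap.eq_adjoint_iff]
  intro x y
  have h1 := inner_apply_comm hA ⟨R' x, h'.mem_domain x⟩ ⟨R y, h.mem_domain y⟩
  rw [h.apply_eq, h'.apply_eq] at h1
  simp only [inner_add_left, inner_add_right, inner_smul_left, inner_smul_right,
    Complex.conj_conj] at h1
  exact (add_right_cancel h1).symm

end SelfAdjoint

/-! ### Representations of `C(X, ℂ)` and their spectral measures -/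

section Representation

variable {𝓗 : Type*} [NormedAddCommGroup 𝓗] [InnerProductSpace ℂ 𝓗] [CompleteSpace 𝓗]
  {X : Type*} [MetricSpace X] [CompactSpace X] [MeasurableSpace X] [BorelSpace X]
  (φ : C(X, ℂ) →⋆ₐ[ℂ] (𝓗 →L[ℂ] 𝓗))

omit [CompactSpace X] [MeasurableSpace X] [BorelSpace X] in
theorem inner_rep_star (f : C(X, ℂ)) (x y : 𝓗) :
    inner ℂ (φ f x) y = inner ℂ x (φ (star f) y) := by
  rw [map_star, ContinuousLinearMap.star_eq_adjoint, ContinuousLinearMap.adjoint_inner_right]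

/-- The functional `f ↦ ⟨x, φ(f) x⟩` on real functions. -/
def repFunctional (x : 𝓗) : CompactlySupportedContinuousMap X ℝ →ₚ[ℝ] ℝ :=
  PositiveLinearMap.mk₀
    { toFun := fun f => (inner ℂ x (φ ((f : C(X, ℝ)).realToRCLike ℂ) x)).re
      map_add' := fun f g => by
        have : ((f + g : CompactlySupportedContinuousMap X ℝ) : C(X, ℝ)).realToRCLike ℂ =
            (f : C(X, ℝ)).realToRCLike ℂ + (g : C(X, ℝ)).realToRCLike ℂ := by
          ext t; simp
        rw [this, map_add, add_apply, inner_add_right, Complex.add_re]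
      map_smul' := fun c f => by
        have : ((c • f : CompactlySupportedContinuousMap X ℝ) : C(X, ℝ)).realToRCLike ℂ =
            (c : ℂ) • (f : C(X, ℝ)).realToRCLike ℂ := by
          ext t; simp
        rw [this, map_smul, smul_apply, inner_smul_right]
        simp }
    (fun f hf => by
      -- Positivity: with `g = √f` the functional takes the value `‖φ(g) x‖²` at `f`.
      let g : C(X, ℂ) := ⟨fun t => ((Real.sqrt (f t) : ℝ) : ℂ), by fun_prop⟩
      have hg : (f : C(X, ℝ)).realToRCLike ℂ = star g * g := by
        ext t
        have ht : 0 ≤ f t := hf t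
        have : ((Real.sqrt (f t) : ℝ) : ℂ) * ((Real.sqrt (f t) : ℝ) : ℂ) = (f t : ℂ) := by
          rw [← Complex.ofReal_mul, Real.mul_self_sqrt ht]
        simp [g, this]
      change 0 ≤ (inner ℂ x (φ ((f : C(X, ℝ)).realToRCLike ℂ) x)).re
      rw [hg, map_mul, mul_apply_eq_comp, ← inner_rep_star]
      exact inner_self_nonneg (𝕜 := ℂ))

/-- The measure `μ_x` with `∫ f dμ_x = ⟨x, φ(f) x⟩`. -/
def repMeasure (x : 𝓗) : Measure X := RealRMK.rieszMeasure (repFunctional φ x)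

instance (x : 𝓗) : IsFiniteMeasure (repMeasure φ x) :=
  inferInstanceAs (IsFiniteMeasure (RealRMK.rieszMeasure (repFunctional φ x)))

theorem integrable_continuousMap {E : Type*} [NormedAddCommGroup E] (f : C(X, E))
    (μ : Measure X) [IsFiniteMeasure μ] : Integrable f μ := by
  have := f.continuous.continuousOn.integrableOn_compact (μ := μ) isCompact_univ
  rwa [integrableOn_univ] at this

theorem re_inner_rep (x : 𝓗) (f : C(X, ℝ)) :
    (inner ℂ x (φ (f.realToRCLike ℂ) x)).re = ∫ t, f t ∂(repMeasure φ x) :=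
  (RealRMK.integral_rieszMeasure (repFunctional φ x)
    (CompactlySupportedContinuousMap.continuousMapEquiv f)).symm

theorem inner_rep_real (x : 𝓗) (f : C(X, ℝ)) :
    inner ℂ x (φ (f.realToRCLike ℂ) x) = ((∫ t, f t ∂(repMeasure φ x) : ℝ) : ℂ) := by
  rw [← re_inner_rep]
  have h : star (f.realToRCLike ℂ) = f.realToRCLike ℂ := by ext t; simp
  have h1 := inner_rep_star φ (f.realToRCLike ℂ) x x
  rw [h, ← inner_conj_symm] at h1
  exact (Complex.conj_eq_iff_re.1 h1).symm

theorem inner_rep (x : 𝓗) (f : C(X, ℂ)) :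
    inner ℂ x (φ f x) = ∫ t, f t ∂(repMeasure φ x) := by
  let a : C(X, ℝ) := ⟨fun t => (f t).re, by fun_prop⟩
  let b : C(X, ℝ) := ⟨fun t => (f t).im, by fun_prop⟩
  have hf : f = a.realToRCLike ℂ + Complex.I • b.realToRCLike ℂ := by
    ext t
    simp only [a, b, ContinuousMap.add_apply, ContinuousMap.smul_apply,
      ContinuousMap.realToRCLike_apply, ContinuousMap.coe_mk, smul_eq_mul]
    rw [mul_comm]
    exact (Complex.re_add_im _).symm
  have hi : Integrable f (repMeasure φ x) := integrable_continuousMap f _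
  have hint := integral_re_add_im (𝕜 := ℂ) hi
  conv_lhs => rw [hf]
  rw [map_add, map_smul, add_apply, smul_apply,
    inner_add_right, inner_smul_right, inner_rep_real, inner_rep_real, ← hint, mul_comm Complex.I]
  rfl

/-- Both squares equal `⟨x, φ(f̄ f) x⟩ = ∫ |f|² dμ_x`. Hence `f ↦ φ(f) x` extends isometrically to
`L²(μ_x)`, which makes indicator functions available. -/
theorem norm_rep (x : 𝓗) (f : C(X, ℂ)) :
    ‖φ f x‖ = ‖ContinuousMap.toLp 2 (repMeasure φ x) ℂ f‖ := by
  have h : (‖φ f x‖ : ℂ) ^ 2 = (‖ContinuousMap.toLp 2 (repMeasure φ x) ℂ f‖ : ℂ) ^ 2 := by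
    have h1 := inner_self_eq_norm_sq_to_K (𝕜 := ℂ) (φ f x)
    have h2 := inner_self_eq_norm_sq_to_K (𝕜 := ℂ) (ContinuousMap.toLp 2 (repMeasure φ x) ℂ f)
    rw [ContinuousMap.inner_toLp] at h2
    rw [inner_rep_star, ← mul_apply_eq_comp, ← map_mul, inner_rep] at h1
    refine h1.symm.trans (Eq.trans ?_ h2)
    refine integral_congr_ae (Filter.Eventually.of_forall fun t => ?_)
    simp [mul_comm]
  have h' : ‖φ f x‖ ^ 2 = ‖ContinuousMap.toLp 2 (repMeasure φ x) ℂ f‖ ^ 2 := by exact_mod_cast h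
  exact (sq_eq_sq₀ (norm_nonneg _) (norm_nonneg _)).1 h'

/-- The isometry `L²(μ_x) → 𝓗` extending `f ↦ φ(f) x`. -/
def repIsometry (x : 𝓗) : Lp ℂ 2 (repMeasure φ x) →L[ℂ] 𝓗 :=
  LinearMap.extendOfNorm
    (E := C(X, ℂ))
    { toFun := fun f => φ f x
      map_add' := fun f g => by rw [map_add, add_apply]
      map_smul' := fun c f => by
        rw [map_smul, smul_apply, RingHom.id_apply] }
    (ContinuousMap.toLp (E := ℂ) 2 (repMeasure φ x) ℂ).toLinearMap

theorem denseRange_toLp (μ : Measure X) [IsFiniteMeasure μ] :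
    DenseRange (ContinuousMap.toLp 2 μ ℂ : C(X, ℂ) →L[ℂ] Lp ℂ 2 μ) :=
  ContinuousMap.toLp_denseRange ℂ μ ℂ (by norm_num)

theorem repIsometry_toLp (x : 𝓗) (f : C(X, ℂ)) :
    repIsometry φ x (ContinuousMap.toLp 2 (repMeasure φ x) ℂ f) = φ f x :=
  LinearMap.extendOfNorm_eq
    (e := (ContinuousMap.toLp (E := ℂ) 2 (repMeasure φ x) ℂ).toLinearMap)
    (denseRange_toLp (repMeasure φ x))
    ⟨1, fun f => by rw [one_mul]; exact (norm_rep φ x f).le⟩ f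

theorem norm_repIsometry (x : 𝓗) (h : Lp ℂ 2 (repMeasure φ x)) :
    ‖repIsometry φ x h‖ = ‖h‖ := by
  refine (denseRange_toLp (repMeasure φ x)).induction_on (p := fun h => ‖repIsometry φ x h‖ = ‖h‖)
    h (isClosed_eq (by fun_prop) (by fun_prop)) fun f => ?_
  rw [repIsometry_toLp, norm_rep]

/-- `x` is the image of the constant `1`, and isometries preserve inner products. -/
theorem inner_repIsometry (x : 𝓗) (h : Lp ℂ 2 (repMeasure φ x)) :
    inner ℂ x (repIsometry φ x h) = ∫ t, h t ∂(repMeasure φ x) := by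
  let V : Lp ℂ 2 (repMeasure φ x) →ₗᵢ[ℂ] 𝓗 :=
    ⟨(repIsometry φ x : Lp ℂ 2 (repMeasure φ x) →ₗ[ℂ] 𝓗), norm_repIsometry φ x⟩
  have h1 : V (ContinuousMap.toLp 2 (repMeasure φ x) ℂ 1) = x := by
    refine (repIsometry_toLp φ x 1).trans ?_
    rw [map_one]; rfl
  have h2 := V.inner_map_map (ContinuousMap.toLp 2 (repMeasure φ x) ℂ 1) h
  rw [h1, L2.inner_def] at h2
  refine h2.trans (integral_congr_ae ?_)
  filter_upwards [ContinuousMap.coeFn_toLp (p := 2) (𝕜 := ℂ) (repMeasure φ x) (1 : C(X, ℂ))]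
    with t ht
  rw [ht]
  simp

/-- The vector `E(B) x`, where `E` is the spectral measure of the representation `φ`. -/
def repVector (x : 𝓗) {B : Set X} (hB : MeasurableSet B) : 𝓗 :=
  repIsometry φ x (indicatorConstLp 2 hB (measure_ne_top _ _) 1)

theorem norm_repVector_sq (x : 𝓗) {B : Set X} (hB : MeasurableSet B) :
    ‖repVector φ x hB‖ ^ 2 = (repMeasure φ x).real B := by
  rw [repVector, norm_repIsometry, norm_indicatorConstLp (by norm_num) (by norm_num)]
  rw [norm_one, one_mul, ENNReal.toReal_ofNat, ← Real.sqrt_eq_rpow, Real.sq_sqrt]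
  positivity

theorem inner_repVector (x : 𝓗) {B : Set X} (hB : MeasurableSet B) :
    inner ℂ x (repVector φ x hB) = ((repMeasure φ x).real B : ℂ) := by
  rw [repVector, inner_repIsometry,
    integral_congr_ae (indicatorConstLp_coeFn (hs := hB) (hμs := measure_ne_top _ _)),
    integral_indicator_const _ hB]
  simp

theorem repMeasure_real_univ (x : 𝓗) : (repMeasure φ x).real Set.univ = ‖x‖ ^ 2 := by
  have h := inner_rep φ x 1
  rw [map_one, one_apply_eq_self, inner_self_eq_norm_sq_to_K] at h
  simp only [ContinuousMap.one_apply, integral_const, Complex.real_smul, mul_one] at h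
  exact Complex.ofReal_injective (h.symm.trans (Complex.ofReal_pow _ _).symm)

/-- `E(B) x` is built in a different space `L²(μ_x)` for each `x`, so linearity in `x` is not
visible. Approximating the indicator in `L²` of the sum of the measures `μ_x`, which dominates each
of them, gives one `f` for all `x ∈ s`; linearity of `φ(f)` is then inherited in the limit. -/
theorem exists_norm_repVector_sub_le (s : Finset 𝓗) {B : Set X} (hB : MeasurableSet B) {ε : ℝ}
    (hε : 0 < ε) : ∃ f : C(X, ℂ), ∀ x ∈ s, ‖repVector φ x hB - φ f x‖ ≤ ε := by
  let μ : Measure X := ∑ x ∈ s, repMeasure φ x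
  have hle : ∀ x ∈ s, repMeasure φ x ≤ μ := fun x hx => by
    refine Measure.le_iff.2 fun C hC => ?_
    rw [Measure.finsetSum_apply]
    exact Finset.single_le_sum (f := fun x => repMeasure φ x C) (fun _ _ => zero_le) hx
  obtain ⟨f, hf⟩ := Metric.denseRange_iff.1 (denseRange_toLp μ)
    (indicatorConstLp 2 hB (measure_ne_top _ _) 1) ε hε
  refine ⟨f, fun x hx => ?_⟩
  rw [← repIsometry_toLp, repVector, ← map_sub, norm_repIsometry]
  rw [dist_eq_norm, Lp.norm_def] at hf
  rw [Lp.norm_def]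
  refine le_trans ?_ hf.le
  refine ENNReal.toReal_mono (Lp.eLpNorm_ne_top _) ?_
  have e : ∀ (ν : Measure X) [IsFiniteMeasure ν],
      eLpNorm (indicatorConstLp 2 hB (measure_ne_top ν _) 1 - ContinuousMap.toLp 2 ν ℂ f :
        Lp ℂ 2 ν) 2 ν = eLpNorm (B.indicator (fun _ => (1 : ℂ)) - ⇑f) 2 ν := fun ν _ =>
    eLpNorm_congr_ae ((Lp.coeFn_sub _ _).trans
      (indicatorConstLp_coeFn.sub (ContinuousMap.coeFn_toLp (p := 2) (𝕜 := ℂ) ν f)))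
  rw [e, e]
  exact eLpNorm_mono_measure _ (hle x hx)

theorem repVector_add (x y : 𝓗) {B : Set X} (hB : MeasurableSet B) :
    repVector φ (x + y) hB = repVector φ x hB + repVector φ y hB := by
  classical
  refine eq_of_norm_sub_le_zero (le_of_forall_pos_le_add fun ε hε => ?_)
  obtain ⟨f, hf⟩ := exists_norm_repVector_sub_le φ {x, y, x + y} hB (ε := ε / 3) (by positivity)
  have h1 := hf x (by simp)
  have h2 := hf y (by simp)
  have h3 := hf (x + y) (by simp)
  have e : repVector φ (x + y) hB - (repVector φ x hB + repVector φ y hB) =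
      (repVector φ (x + y) hB - φ f (x + y)) - (repVector φ x hB - φ f x)
        - (repVector φ y hB - φ f y) := by
    rw [map_add]; abel
  rw [e]
  have := norm_sub_le ((repVector φ (x + y) hB - φ f (x + y)) - (repVector φ x hB - φ f x))
    (repVector φ y hB - φ f y)
  have := norm_sub_le (repVector φ (x + y) hB - φ f (x + y)) (repVector φ x hB - φ f x)
  linarith

theorem repVector_smul (c : ℂ) (x : 𝓗) {B : Set X} (hB : MeasurableSet B) :
    repVector φ (c • x) hB = c • repVector φ x hB := by
  classical
  refine eq_of_norm_sub_le_zero (le_of_forall_pos_le_add fun ε hε => ?_)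
  obtain ⟨f, hf⟩ := exists_norm_repVector_sub_le φ {x, c • x} hB (ε := ε / (1 + ‖c‖))
    (by positivity)
  have h1 := hf x (by simp)
  have h3 := hf (c • x) (by simp)
  have e : repVector φ (c • x) hB - c • repVector φ x hB =
      (repVector φ (c • x) hB - φ f (c • x)) - c • (repVector φ x hB - φ f x) := by
    rw [map_smul, smul_sub]; abel
  rw [e]
  have h4 := norm_sub_le (repVector φ (c • x) hB - φ f (c • x)) (c • (repVector φ x hB - φ f x))
  rw [norm_smul] at h4
  have h5 : ‖c‖ * ‖repVector φ x hB - φ f x‖ ≤ ‖c‖ * (ε / (1 + ‖c‖)) := by gcongr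
  have h6 : ε / (1 + ‖c‖) + ‖c‖ * (ε / (1 + ‖c‖)) = ε := by
    have : (1 + ‖c‖) ≠ 0 := by positivity
    field_simp
  linarith

/-- The spectral projection `E(B)` of the representation `φ`. -/
def repProj {B : Set X} (hB : MeasurableSet B) : 𝓗 →L[ℂ] 𝓗 :=
  LinearMap.mkContinuous
    { toFun := fun x => repVector φ x hB
      map_add' := fun x y => repVector_add φ x y hB
      map_smul' := fun c x => repVector_smul φ c x hB } 1 fun x => by
    rw [one_mul]
    refine (sq_le_sq₀ (norm_nonneg _) (norm_nonneg _)).1 ?_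
    change ‖repVector φ x hB‖ ^ 2 ≤ _
    rw [norm_repVector_sq, ← repMeasure_real_univ φ x]
    exact measureReal_mono (Set.subset_univ _)

theorem repProj_apply (x : 𝓗) {B : Set X} (hB : MeasurableSet B) :
    repProj φ hB x = repVector φ x hB := rfl

/-- The quadratic forms of `Q* Q` and `Q` coincide, so `Q* Q = Q` by complex polarization. Thus `Q`
is self-adjoint, and then idempotent. -/
theorem isStarProjection_of_inner_eq {Q : 𝓗 →L[ℂ] 𝓗}
    (h : ∀ x, inner ℂ x (Q x) = ((‖Q x‖ ^ 2 : ℝ) : ℂ)) : IsStarProjection Q := by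
  have e : star Q * Q = Q := by
    refine (ContinuousLinearMap.ext_iff.2 ?_)
    have := (ext_inner_map (star Q * Q : 𝓗 →L[ℂ] 𝓗).toLinearMap Q.toLinearMap).1 fun x => by
      change inner ℂ ((star Q * Q) x) x = inner ℂ (Q x) x
      rw [mul_apply_eq_comp, ContinuousLinearMap.star_eq_adjoint,
        ContinuousLinearMap.adjoint_inner_left, inner_self_eq_norm_sq_to_K,
        ← inner_conj_symm (Q x) x, h, Complex.conj_ofReal]
      simp
    exact fun x => congrArg (fun T : 𝓗 →ₗ[ℂ] 𝓗 => T x) this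
  have hs : IsSelfAdjoint Q := by
    rw [← e]
    exact IsSelfAdjoint.star_mul_self Q
  refine ⟨?_, hs⟩
  rwa [hs.star_eq] at e

theorem isStarProjection_repProj {B : Set X} (hB : MeasurableSet B) :
    IsStarProjection (repProj φ hB) :=
  isStarProjection_of_inner_eq fun x => by
    rw [repProj_apply, inner_repVector, norm_repVector_sq]

theorem sum_repVector (x : 𝓗) {B : ℕ → Set X} (hB : ∀ n, MeasurableSet (B n))
    (hd : Pairwise fun m n => Disjoint (B m) (B n)) (s : Finset ℕ) :
    ∑ n ∈ s, repVector φ x (hB n) =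
      repVector φ x (s.measurableSet_biUnion fun n _ => hB n) := by
  classical
  induction s using Finset.induction_on with
  | empty => simp [repVector, indicatorConstLp_empty]
  | insert a s ha ih =>
    have hdis : Disjoint (B a) (⋃ n ∈ s, B n) := by
      rw [Set.disjoint_iUnion₂_right]
      intro n hn
      exact hd fun h => ha (h ▸ hn)
    rw [Finset.sum_insert ha, ih]
    simp only [repVector, ← map_add]
    congr 1
    rw [← indicatorConstLp_disjoint_union (hB a) (s.measurableSet_biUnion fun n _ => hB n)
      (measure_ne_top _ _) (measure_ne_top _ _) hdis (1 : ℂ)]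
    simp only [Finset.set_biUnion_insert]

/-- Indicators of finite unions converge in `L²(μ_x)`, since the symmetric differences are bounded
by tails of a convergent sum of measures; the isometry transports the convergence. -/
theorem hasSum_repVector (x : 𝓗) {B : ℕ → Set X} (hB : ∀ n, MeasurableSet (B n))
    (hd : Pairwise fun m n => Disjoint (B m) (B n)) :
    HasSum (fun n => repVector φ x (hB n)) (repVector φ x (MeasurableSet.iUnion hB)) := by
  rw [HasSum]
  simp_rw [sum_repVector φ x hB hd]
  refine ((repIsometry φ x).continuous.tendsto _).comp
    (tendsto_indicatorConstLp_set (by norm_num) ?_)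
  have hfin : ∑' n, repMeasure φ x (B n) ≠ ∞ := by
    rw [← measure_iUnion hd hB]
    exact measure_ne_top _ _
  refine tendsto_of_tendsto_of_tendsto_of_le_of_le tendsto_const_nhds
    (ENNReal.tendsto_tsum_compl_atTop_zero hfin) (fun _ => zero_le) fun s => ?_
  have hsub : symmDiff (⋃ n ∈ s, B n) (⋃ n, B n) ⊆ ⋃ n : {n // n ∉ s}, B n := by
    intro t ht
    rcases ht with ⟨h1, h2⟩ | ⟨h1, h2⟩
    · simp only [Set.mem_iUnion] at h1 h2
      obtain ⟨n, _, hn⟩ := h1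
      exact absurd ⟨n, hn⟩ h2
    · simp only [Set.mem_iUnion, not_exists] at h1 h2 ⊢
      obtain ⟨n, hn⟩ := h1
      exact ⟨⟨n, fun hs => h2 n hs hn⟩, hn⟩
  exact (measure_mono hsub).trans (measure_iUnion_le _)

theorem repVector_univ (x : 𝓗) : repVector φ x MeasurableSet.univ = x := by
  have h : (indicatorConstLp 2 MeasurableSet.univ (measure_ne_top (repMeasure φ x) _) (1 : ℂ)) =
      ContinuousMap.toLp 2 (repMeasure φ x) ℂ 1 := by
    refine Lp.ext ?_
    filter_upwards [indicatorConstLp_coeFn (p := 2) (hs := MeasurableSet.univ)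
      (hμs := measure_ne_top (repMeasure φ x) _) (c := (1 : ℂ)),
      ContinuousMap.coeFn_toLp (p := 2) (𝕜 := ℂ) (repMeasure φ x) (1 : C(X, ℂ))] with t h1 h2
    rw [h1, h2]
    simp
  rw [repVector, h, repIsometry_toLp, map_one]
  rfl

/-- `φ(g)` acts on the image of `L²(μ_x)` as multiplication by `g`. -/
theorem rep_apply_repIsometry (x : 𝓗) (g : C(X, ℂ)) (h k : Lp ℂ 2 (repMeasure φ x))
    (hk : k =ᵐ[repMeasure φ x] fun t => g t * h t) :
    φ g (repIsometry φ x h) = repIsometry φ x k := by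
  refine eq_of_norm_sub_le_zero (le_of_forall_pos_le_add fun ε hε => ?_)
  set C : ℝ := ‖φ g‖ + ‖g‖ + 1 with hC
  have hC0 : 0 < C := by positivity
  -- For continuous `f` near `h`, both sides are close to `φ(g f) x`, with errors controlled by `‖φ
  -- g‖` and `‖g‖`; the summand `1` in `C` only keeps it positive.
  obtain ⟨f, hf⟩ := Metric.denseRange_iff.1 (denseRange_toLp (repMeasure φ x)) h (ε / C)
    (by positivity)
  rw [dist_eq_norm] at hf
  have h1 : ‖φ g (repIsometry φ x h) - φ (g * f) x‖ ≤ ‖φ g‖ * (ε / C) := by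
    rw [map_mul, mul_apply_eq_comp, ← map_sub, ← repIsometry_toLp φ x f, ← map_sub]
    refine ((φ g).le_opNorm _).trans ?_
    rw [norm_repIsometry]
    gcongr
  have h2 : ‖repIsometry φ x k - φ (g * f) x‖ ≤ ‖g‖ * (ε / C) := by
    rw [← repIsometry_toLp, ← map_sub, norm_repIsometry]
    refine (Lp.norm_le_mul_norm_of_ae_le_mul (c := ‖g‖)
      (g := h - ContinuousMap.toLp 2 (repMeasure φ x) ℂ f) ?_).trans (by gcongr)
    filter_upwards [hk, Lp.coeFn_sub k (ContinuousMap.toLp 2 (repMeasure φ x) ℂ (g * f)),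
      Lp.coeFn_sub h (ContinuousMap.toLp 2 (repMeasure φ x) ℂ f),
      ContinuousMap.coeFn_toLp (p := 2) (𝕜 := ℂ) (repMeasure φ x) (g * f),
      ContinuousMap.coeFn_toLp (p := 2) (𝕜 := ℂ) (repMeasure φ x) f] with t e1 e2 e3 e4 e5
    rw [e2, e3, Pi.sub_apply, Pi.sub_apply, e1, e4, e5, ContinuousMap.mul_apply, ← mul_sub,
      norm_mul]
    gcongr
    exact g.norm_coe_le_norm t
  have e : φ g (repIsometry φ x h) - repIsometry φ x k =
      (φ g (repIsometry φ x h) - φ (g * f) x) - (repIsometry φ x k - φ (g * f) x) := by abel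
  rw [e]
  refine (norm_sub_le _ _).trans ?_
  have h3 : ‖φ g‖ * (ε / C) + ‖g‖ * (ε / C) ≤ C * (ε / C) := by
    rw [← add_mul]
    gcongr
    linarith
  have h4 : C * (ε / C) = ε := by field_simp
  linarith

/-- `dμ_{φ(g) y} = |g|² dμ_y`. -/
theorem repMeasure_rep_apply (y : 𝓗) (g : C(X, ℂ)) :
    repMeasure φ (φ g y) =
      (repMeasure φ y).withDensity fun t => ENNReal.ofReal (‖g t‖ ^ 2) := by
  have hgm : Measurable fun t => ENNReal.ofReal (‖g t‖ ^ 2) := by fun_prop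
  have hgi : Integrable (fun t => ‖g t‖ ^ 2) (repMeasure φ y) :=
    integrable_continuousMap ⟨fun t => ‖g t‖ ^ 2, by fun_prop⟩ _
  have : IsFiniteMeasure ((repMeasure φ y).withDensity fun t => ENNReal.ofReal (‖g t‖ ^ 2)) :=
    isFiniteMeasure_withDensity_ofReal hgi.2
  refine ext_of_forall_integral_eq_of_IsFiniteMeasure fun f => ?_
  have h1 := re_inner_rep φ (φ g y) f.toContinuousMap
  have h2 : (inner ℂ (φ g y) (φ (f.toContinuousMap.realToRCLike ℂ) (φ g y))) =
      ((∫ t, ‖g t‖ ^ 2 * f t ∂(repMeasure φ y) : ℝ) : ℂ) := by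
    rw [inner_rep_star, ← mul_apply_eq_comp, ← mul_apply_eq_comp,
      ← map_mul, ← map_mul, inner_rep, ← integral_complex_ofReal]
    refine integral_congr_ae (Filter.Eventually.of_forall fun t => ?_)
    have := Complex.conj_mul' (g t)
    simp only [ContinuousMap.mul_apply, ContinuousMap.star_apply, ContinuousMap.realToRCLike_apply]
    push_cast
    rw [← this]
    simp only [RCLike.star_def]
    change _ * (f t : ℂ) * _ = _
    ring
  rw [h2, Complex.ofReal_re] at h1
  refine h1.symm.trans ?_
  rw [integral_withDensity_eq_integral_toReal_smul hgm (by simp)]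
  refine integral_congr_ae (Filter.Eventually.of_forall fun t => ?_)
  simp only [smul_eq_mul]
  rw [ENNReal.toReal_ofReal (by positivity)]

end Representation

/-! ### Existence of the spectral measure of a self-adjoint operator -/

section Existence

variable {𝓗 : Type*} [NormedAddCommGroup 𝓗] [InnerProductSpace ℂ 𝓗] [CompleteSpace 𝓗]
  {A : 𝓗 →ₗ.[ℂ] 𝓗}

/-- `R*` is the resolvent at `-i`; the two identities are the first resolvent identity for the pairs
`(i, -i)` and `(-i, i)`. Comparing them shows that `R` is normal. -/
theorem IsResolventAt.sub_star_eq (hA : IsSelfAdjoint A) {R : 𝓗 →L[ℂ] 𝓗}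
    (h : IsResolventAt A Complex.I R) :
    R - star R = (2 * Complex.I) • (R * star R) ∧ R - star R = (2 * Complex.I) • (star R * R) := by
  obtain ⟨R', hR'⟩ := exists_isResolventAt hA
    (z := (starRingEnd ℂ) Complex.I) (by simp)
  rw [h.adjoint_eq hA hR']
  constructor <;> ext x
  · have := h.sub_eq hR' x
    rw [sub_apply, this, smul_apply, mul_apply_eq_comp, Complex.conj_I]
    congr 1
    ring
  · have := hR'.sub_eq h x
    rw [sub_apply, ← neg_sub, this, smul_apply, mul_apply_eq_comp, Complex.conj_I, ← neg_smul]
    congr 1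
    ring

theorem IsResolventAt.isStarNormal (hA : IsSelfAdjoint A) {R : 𝓗 →L[ℂ] 𝓗}
    (h : IsResolventAt A Complex.I R) : IsStarNormal R := by
  obtain ⟨h1, h2⟩ := h.sub_star_eq hA
  refine ⟨?_⟩
  have h3 := h2.symm.trans h1
  exact smul_right_injective (𝓗 →L[ℂ] 𝓗) (r := 2 * Complex.I) (by simp) h3

/-- The functional calculus turns `R - R* = 2i R R*` into `z - z̄ = 2i |z|²`. This circle is the
image of `ℝ ∪ {∞}` under `t ↦ (t - i)⁻¹`. -/
theorem IsResolventAt.im_eq_of_mem_spectrum (hA : IsSelfAdjoint A) {R : 𝓗 →L[ℂ] 𝓗}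
    (h : IsResolventAt A Complex.I R) {z : ℂ} (hz : z ∈ spectrum ℂ R) : z.im = ‖z‖ ^ 2 := by
  have hn := h.isStarNormal hA
  let ζ : C(spectrum ℂ R, ℂ) := (ContinuousMap.id ℂ).restrict (spectrum ℂ R)
  have hζ : cfcHom hn ζ = R := cfcHom_id hn
  have e : ζ - star ζ = (2 * Complex.I) • (ζ * star ζ) := by
    apply cfcHom_injective hn
    rw [map_sub, map_smul, map_mul, map_star, hζ]
    exact (h.sub_star_eq hA).1
  have h1 : z - (starRingEnd ℂ) z = (2 * Complex.I) * (z * (starRingEnd ℂ) z) :=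
    congrArg (fun f : C(spectrum ℂ R, ℂ) => f ⟨z, hz⟩) e
  rw [Complex.mul_conj', Complex.sub_conj] at h1
  rw [← Complex.ofReal_pow] at h1
  have h2 := congrArg Complex.im h1
  rw [Complex.im_mul_ofReal] at h2
  simp at h2
  linarith

/-- If `z = (t - i)⁻¹` with `t` real, this is `t`. -/
def invCayley {s : Set ℂ} (z : s) : ℝ := ((z : ℂ)⁻¹).re

theorem measurable_invCayley {s : Set ℂ} : Measurable (invCayley (s := s)) :=
  Complex.measurable_re.comp (measurable_subtype_coe.inv)

open scoped Classical in
/-- The projection-valued measure on `ℝ` obtained from a representation of `C(s)`, `s ⊆ ℂ`. -/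
def cayleyPVMeasure {s : Set ℂ} [CompactSpace s] (φ : C(s, ℂ) →⋆ₐ[ℂ] (𝓗 →L[ℂ] 𝓗)) :
    PVMeasure 𝓗 where
  proj B := if h : MeasurableSet B then repProj φ (measurable_invCayley h) else 0
  isStarProjection B hB := by
    rw [dif_pos hB]
    exact isStarProjection_repProj φ _
  univ := by
    rw [dif_pos MeasurableSet.univ]
    ext x
    exact repVector_univ φ x
  hasSum_iUnion B hB hd x := by
    rw [dif_pos (MeasurableSet.iUnion hB)]
    simp_rw [dif_pos (hB _), repProj_apply, Set.preimage_iUnion]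
    exact hasSum_repVector φ x (fun n => measurable_invCayley (hB n))
      fun m n hmn => (hd hmn).preimage _

theorem cayleyPVMeasure_scalarMeasure {s : Set ℂ} [CompactSpace s]
    (φ : C(s, ℂ) →⋆ₐ[ℂ] (𝓗 →L[ℂ] 𝓗)) (x : 𝓗) :
    (cayleyPVMeasure φ).scalarMeasure x = (repMeasure φ x).map invCayley := by
  ext B hB
  rw [PVMeasure.scalarMeasure, Measure.ofMeasurable_apply _ hB,
    Measure.map_apply measurable_invCayley hB]
  simp only [cayleyPVMeasure, dif_pos hB]
  rw [repProj_apply, inner_repVector, Complex.ofReal_re, ofReal_measureReal]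

/-- Existence part of the spectral theorem. -/
theorem exists_isSpectralMeasure (hA : IsSelfAdjoint A) : ∃ E, IsSpectralMeasure A E := by
  obtain ⟨R, hR⟩ := exists_isResolventAt hA (z := Complex.I) (by simp)
  have hn := hR.isStarNormal hA
  let φ : C(spectrum ℂ R, ℂ) →⋆ₐ[ℂ] (𝓗 →L[ℂ] 𝓗) := cfcHom hn
  let ζ : C(spectrum ℂ R, ℂ) := (ContinuousMap.id ℂ).restrict (spectrum ℂ R)
  have hζ : φ ζ = R := cfcHom_id hn
  have hζ' : ∀ x, R x = φ ζ x := fun x => by rw [hζ]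
  have hval : ∀ z, ζ z = z := fun z => rfl
  have him : ∀ z : spectrum ℂ R, (z : ℂ).im = ‖(z : ℂ)‖ ^ 2 := fun z =>
    hR.im_eq_of_mem_spectrum hA z.2
  -- The point `0` corresponds to `t = ∞`, where `invCayley` takes the default value `0`. It carries
  -- no mass, because `R` is injective and annihilates `E({0}) x`.
  have hnull : ∀ x, ∀ᵐ z : spectrum ℂ R ∂(repMeasure φ x), (z : ℂ) ≠ 0 := by
    intro x
    have hB : MeasurableSet {z : spectrum ℂ R | (z : ℂ) = 0} :=
      measurable_subtype_coe (measurableSet_singleton (0 : ℂ))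
    have h0 : R (repVector φ x hB) = 0 := by
      refine (hζ' _).trans ((rep_apply_repIsometry φ x ζ _ 0 ?_).trans (map_zero _))
      filter_upwards [Lp.coeFn_zero ℂ 2 (repMeasure φ x), indicatorConstLp_coeFn (p := 2)
        (hs := hB) (hμs := measure_ne_top (repMeasure φ x) _) (c := (1 : ℂ))] with z h1 h2
      rw [h1, h2, hval]
      by_cases hz : (z : ℂ) = 0
      · simp [hz]
      · simp [Set.indicator, hz]
    have h1 := norm_repVector_sq φ x hB
    rw [hR.injective h0, norm_zero, zero_pow two_ne_zero] at h1
    rw [ae_iff]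
    simp only [not_not]
    exact (measureReal_eq_zero_iff (measure_ne_top _ _)).1 h1.symm
  have hRmeas : ∀ y, repMeasure φ (R y) =
      (repMeasure φ y).withDensity fun z => ENNReal.ofReal (‖(z : ℂ)‖ ^ 2) := by
    intro y
    have := repMeasure_rep_apply φ y ζ
    rwa [hζ] at this
  have hle : ∀ z : spectrum ℂ R, invCayley z ^ 2 ≤ ‖(z : ℂ)⁻¹‖ ^ 2 := fun z => by
    rw [← sq_abs]
    exact pow_le_pow_left₀ (abs_nonneg _) (Complex.abs_re_le_norm _) 2
  refine ⟨cayleyPVMeasure φ, ⟨fun x => ?_, fun x => ?_⟩⟩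
  · rw [cayleyPVMeasure_scalarMeasure,
      lintegral_map (by fun_prop) measurable_invCayley]
    constructor
    -- Here `x = R y` and `dμ_x = |z|² dμ_y`, so the weight `|z|²` compensates `t² ≤ |z|⁻²`.
    · intro hx
      have hx' := hR.left_inv ⟨x, hx⟩
      set y := A ⟨x, hx⟩ - Complex.I • x with hy
      change R y = x at hx'
      rw [← hx', hRmeas, lintegral_withDensity_eq_lintegral_mul _ (by fun_prop)
        ((measurable_invCayley.pow_const 2).ennreal_ofReal)]
      refine lt_of_le_of_lt (lintegral_mono (g := fun _ => 1) fun z => ?_) ?_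
      · simp only [Pi.mul_apply]
        rw [← ENNReal.ofReal_mul (by positivity), ← ENNReal.ofReal_one]
        refine ENNReal.ofReal_le_ofReal ?_
        calc ‖(z : ℂ)‖ ^ 2 * invCayley z ^ 2 ≤ ‖(z : ℂ)‖ ^ 2 * ‖(z : ℂ)⁻¹‖ ^ 2 := by
              exact mul_le_mul_of_nonneg_left (hle z) (sq_nonneg _)
          _ = (‖(z : ℂ) * (z : ℂ)⁻¹‖) ^ 2 := by rw [norm_mul, mul_pow]
          _ ≤ 1 := by
              by_cases hz : (z : ℂ) = 0
              · simp [hz]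
              · simp [mul_inv_cancel₀ hz]
      · simp
    · intro hfin
      have hm : AEStronglyMeasurable (fun z : spectrum ℂ R => (z : ℂ)⁻¹) (repMeasure φ x) :=
        (measurable_subtype_coe.inv).aestronglyMeasurable
      -- On the circle `Im z⁻¹ = -1`, hence `|z⁻¹|² = t² + 1` off `0`. The vector represented by
      -- `z⁻¹` in `L²(μ_x)` is then a preimage of `x` under `R`.
      have hL : MemLp (fun z : spectrum ℂ R => (z : ℂ)⁻¹) 2 (repMeasure φ x) := by
        rw [memLp_two_iff_integrable_sq_norm hm]
        refine Integrable.mono' (g := fun z => invCayley z ^ 2 + 1) ?_ (hm.norm.pow 2) ?_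
        · refine Integrable.add ⟨(measurable_invCayley.pow_const 2).aestronglyMeasurable, ?_⟩
            (integrable_const _)
          rw [hasFiniteIntegral_iff_ofReal (Filter.Eventually.of_forall fun z => sq_nonneg _)]
          exact hfin
        · refine Filter.Eventually.of_forall fun z => ?_
          rw [Real.norm_of_nonneg (by positivity)]
          by_cases hz : (z : ℂ) = 0
          · rw [hz, inv_zero, norm_zero]
            rw [zero_pow two_ne_zero]
            positivity
          · have hz' : ‖(z : ℂ)‖ ≠ 0 := norm_ne_zero_iff.2 hz
            have h1 : ((z : ℂ)⁻¹).im = -1 := by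
              rw [Complex.inv_im, Complex.normSq_eq_norm_sq, him z]
              field_simp
            rw [← Complex.normSq_eq_norm_sq, Complex.normSq_apply, h1, invCayley]
            nlinarith
      have e : R (repIsometry φ x hL.toLp) = x := by
        refine (hζ' _).trans ((rep_apply_repIsometry φ x ζ _ _ ?_).trans (repVector_univ φ x))
        filter_upwards [hL.coeFn_toLp, indicatorConstLp_coeFn (p := 2) (hs := MeasurableSet.univ)
          (hμs := measure_ne_top (repMeasure φ x) _) (c := (1 : ℂ)), hnull x] with z h1 h2 h3
        rw [h1, h2, hval, mul_inv_cancel₀ h3]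
        simp
      rw [← e]
      exact hR.mem_domain _
  · have hx' := hR.left_inv x
    set y := A x - Complex.I • (x : 𝓗) with hy
    have hAx : A x = y + Complex.I • R y := by
      rw [hx', hy]; abel
    rw [cayleyPVMeasure_scalarMeasure,
      integral_map measurable_invCayley.aemeasurable (by fun_prop), hAx, ← hx', hRmeas,
      integral_withDensity_eq_integral_toReal_smul (by fun_prop) (by simp)]
    -- The integrand becomes `z̄ + i|z|²`, which on the circle equals `Re z = |z|² t`.
    have h1 : inner ℂ (R y) (y + Complex.I • R y) =
        inner ℂ y (φ (star ζ + Complex.I • (star ζ * ζ)) y) := by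
      rw [map_add, map_smul, map_mul, add_apply, smul_apply, mul_apply_eq_comp, inner_add_right,
        inner_add_right, inner_smul_right, inner_smul_right, ← inner_rep_star, ← inner_rep_star,
        hζ]
    rw [h1, inner_rep, ← integral_complex_ofReal]
    refine integral_congr_ae (Filter.Eventually.of_forall fun z => ?_)
    have h2 : ‖(z : ℂ)‖ ^ 2 * invCayley z = (z : ℂ).re := by
      rw [invCayley, Complex.inv_re, Complex.normSq_eq_norm_sq]
      by_cases hz : (z : ℂ) = 0
      · simp [hz]
      · have hz' : ‖(z : ℂ)‖ ≠ 0 := norm_ne_zero_iff.2 hz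
        field_simp
    have h3 : (star ζ + Complex.I • (star ζ * ζ)) z =
        (starRingEnd ℂ) (z : ℂ) + Complex.I * ((starRingEnd ℂ) (z : ℂ) * (z : ℂ)) := rfl
    simp only [smul_eq_mul]
    rw [h3, ENNReal.toReal_ofReal (by positivity), h2, Complex.conj_mul', ← Complex.ofReal_pow,
      ← him z]
    apply Complex.ext <;> simp

end Existence

/-! ### Projection-valued measures -/

section PVM

variable {𝓗 : Type*} [NormedAddCommGroup 𝓗] [InnerProductSpace ℂ 𝓗] [CompleteSpace 𝓗]

namespace PVMeasure

variable (E : PVMeasure 𝓗) {B C : Set ℝ}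

theorem inner_proj (hB : MeasurableSet B) (x y : 𝓗) :
    inner ℂ (E.proj B x) y = inner ℂ x (E.proj B y) := by
  have h2 : ContinuousLinearMap.adjoint (E.proj B) = E.proj B :=
    (E.isStarProjection B hB).isSelfAdjoint.star_eq
  conv_rhs => rw [← h2]
  rw [ContinuousLinearMap.adjoint_inner_right]

theorem proj_proj_self (hB : MeasurableSet B) (x : 𝓗) : E.proj B (E.proj B x) = E.proj B x :=
  congrArg (fun T : 𝓗 →L[ℂ] 𝓗 => T x) (E.isStarProjection B hB).isIdempotentElem.eq

theorem inner_proj_self (hB : MeasurableSet B) (x : 𝓗) :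
    inner ℂ x (E.proj B x) = ((‖E.proj B x‖ ^ 2 : ℝ) : ℂ) := by
  rw [← E.proj_proj_self hB, ← E.inner_proj hB, E.proj_proj_self hB, inner_self_eq_norm_sq_to_K]
  exact (Complex.ofReal_pow _ _).symm

theorem scalarMeasure_apply (hB : MeasurableSet B) (x : 𝓗) :
    E.scalarMeasure x B = ENNReal.ofReal (‖E.proj B x‖ ^ 2) := by
  rw [scalarMeasure, Measure.ofMeasurable_apply _ hB, E.inner_proj_self hB, Complex.ofReal_re]

instance (x : 𝓗) : IsFiniteMeasure (E.scalarMeasure x) :=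
  ⟨by rw [E.scalarMeasure_apply MeasurableSet.univ]; exact ENNReal.ofReal_lt_top⟩

theorem scalarMeasure_real (hB : MeasurableSet B) (x : 𝓗) :
    (E.scalarMeasure x).real B = ‖E.proj B x‖ ^ 2 := by
  rw [measureReal_def, E.scalarMeasure_apply hB, ENNReal.toReal_ofReal (sq_nonneg _)]

theorem scalarMeasure_real_univ (x : 𝓗) : (E.scalarMeasure x).real Set.univ = ‖x‖ ^ 2 := by
  rw [E.scalarMeasure_real MeasurableSet.univ, E.univ, one_apply_eq_self]

theorem scalarMeasure_eq_zero_iff (hB : MeasurableSet B) (x : 𝓗) :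
    E.scalarMeasure x B = 0 ↔ E.proj B x = 0 := by
  rw [E.scalarMeasure_apply hB, ENNReal.ofReal_eq_zero]
  constructor
  · intro h
    have : ‖E.proj B x‖ ^ 2 = 0 := le_antisymm h (sq_nonneg _)
    exact norm_eq_zero.1 (pow_eq_zero_iff two_ne_zero |>.1 this)
  · intro h
    simp [h]

theorem proj_union (hB : MeasurableSet B) (hC : MeasurableSet C) (hd : Disjoint B C) (x : 𝓗) :
    E.proj (B ∪ C) x = E.proj B x + E.proj C x := by
  let f : ℕ → Set ℝ := fun n => if n = 0 then B else if n = 1 then C else ∅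
  have h0 : f 0 = B := rfl
  have h1 : f 1 = C := rfl
  have h2 : ∀ n, f (n + 2) = ∅ := fun n => by simp [f]
  have hU : ⋃ n, f n = B ∪ C := by
    ext t
    simp only [Set.mem_iUnion, Set.mem_union]
    constructor
    · rintro ⟨n, hn⟩
      match n, hn with
      | 0, hn => exact Or.inl hn
      | 1, hn => exact Or.inr hn
      | n + 2, hn => rw [h2] at hn; exact hn.elim
    · rintro (h | h)
      exacts [⟨0, h⟩, ⟨1, h⟩]
  have hm : ∀ n, MeasurableSet (f n) := fun n => by
    match n with
    | 0 => exact hB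
    | 1 => exact hC
    | n + 2 => rw [h2]; exact MeasurableSet.empty
  have hdis : Pairwise fun m n => Disjoint (f m) (f n) := fun m n hmn => by
    match m, n with
    | 0, 0 => exact absurd rfl hmn
    | 0, 1 => exact hd
    | 1, 0 => exact hd.symm
    | 1, 1 => exact absurd rfl hmn
    | m + 2, n => change Disjoint (f (m + 2)) (f n); rw [h2]; exact disjoint_bot_left
    | m, n + 2 => change Disjoint (f m) (f (n + 2)); rw [h2]; exact disjoint_bot_right
  have hs := E.hasSum_iUnion f hm hdis x
  rw [hU] at hs
  have hz : ∀ n ∉ ({0, 1} : Finset ℕ), E.proj (f n) x = 0 := fun n hn => by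
    match n, hn with
    | 0, hn => simp at hn
    | 1, hn => simp at hn
    | n + 2, hn => rw [h2, E.empty]
  rw [hs.unique (hasSum_sum_of_ne_finset_zero hz), Finset.sum_pair zero_ne_one, h0, h1]

theorem proj_compl (hB : MeasurableSet B) (x : 𝓗) : E.proj Bᶜ x = x - E.proj B x := by
  have h := E.proj_union hB hB.compl disjoint_compl_right x
  rw [Set.union_compl_self, E.univ, one_apply_eq_self] at h
  rw [eq_sub_iff_add_eq', ← h]

/-- Multiplicativity of `E` has to be derived from additivity: the scalar measure of `E(C) x`
vanishes on `Cᶜ`, hence on the subset `B`. -/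
theorem proj_proj_of_disjoint (hB : MeasurableSet B) (hC : MeasurableSet C) (hd : Disjoint B C)
    (x : 𝓗) : E.proj B (E.proj C x) = 0 := by
  have h : E.proj Cᶜ (E.proj C x) = 0 := by
    rw [E.proj_compl hC, E.proj_proj_self hC, sub_self]
  rw [← E.scalarMeasure_eq_zero_iff hC.compl] at h
  rw [← E.scalarMeasure_eq_zero_iff hB]
  exact measure_mono_null hd.subset_compl_right h

theorem proj_proj (hB : MeasurableSet B) (hC : MeasurableSet C) (x : 𝓗) :
    E.proj B (E.proj C x) = E.proj (B ∩ C) x := by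
  have h1 := E.proj_union (hB.inter hC) (hB.diff hC) Set.disjoint_sdiff_inter.symm (E.proj C x)
  rw [Set.inter_union_sdiff, E.proj_proj_of_disjoint (hB.diff hC) hC Set.disjoint_sdiff_left,
    add_zero] at h1
  have h2 : E.proj C x = x - E.proj Cᶜ x := by rw [E.proj_compl hC]; abel
  rw [h1, h2, map_sub, E.proj_proj_of_disjoint (hB.inter hC) hC.compl
    (disjoint_compl_right.mono_left Set.inter_subset_right), sub_zero]

theorem proj_comm (hB : MeasurableSet B) (hC : MeasurableSet C) (x : 𝓗) :
    E.proj B (E.proj C x) = E.proj C (E.proj B x) := by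
  rw [E.proj_proj hB hC, E.proj_proj hC hB, Set.inter_comm]

theorem scalarMeasure_proj (hB : MeasurableSet B) (x : 𝓗) :
    E.scalarMeasure (E.proj B x) = (E.scalarMeasure x).restrict B := by
  ext C hC
  rw [Measure.restrict_apply hC, E.scalarMeasure_apply hC, E.scalarMeasure_apply (hC.inter hB),
    E.proj_proj hC hB]

theorem norm_proj_le (hB : MeasurableSet B) (x : 𝓗) : ‖E.proj B x‖ ≤ ‖x‖ := by
  refine (sq_le_sq₀ (norm_nonneg _) (norm_nonneg _)).1 ?_
  rw [← E.scalarMeasure_real hB, ← E.scalarMeasure_real_univ x]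
  exact measureReal_mono (Set.subset_univ _)

/-- `E(B)` commutes with `E(C)`, so `E(C) a` and `E(C) b` stay orthogonal and Pythagoras applies. -/
theorem scalarMeasure_add (hB : MeasurableSet B) {a b : 𝓗} (ha : E.proj B a = a)
    (hb : E.proj B b = 0) :
    E.scalarMeasure (a + b) = E.scalarMeasure a + E.scalarMeasure b := by
  ext C hC
  rw [Measure.add_apply, E.scalarMeasure_apply hC, E.scalarMeasure_apply hC,
    E.scalarMeasure_apply hC, ← ENNReal.ofReal_add (sq_nonneg _) (sq_nonneg _), map_add]
  have h : inner ℂ (E.proj C a) (E.proj C b) = 0 := by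
    rw [← ha, E.proj_comm hC hB, E.inner_proj hB, E.proj_comm hB hC, hb, map_zero,
      inner_zero_right]
  have := norm_add_sq_eq_norm_sq_add_norm_sq_of_inner_eq_zero _ _ h
  rw [← sq, ← sq, ← sq] at this
  rw [this]

end PVMeasure

end PVM

/-! ### From the quadratic form to the resolvent formula -/

section SpectralMeasure

variable {𝓗 : Type*} [NormedAddCommGroup 𝓗] [InnerProductSpace ℂ 𝓗] [CompleteSpace 𝓗]
  {A : 𝓗 →ₗ.[ℂ] 𝓗} {E : PVMeasure 𝓗} {B : Set ℝ}

namespace IsSpectralMeasure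

theorem integrable_id (hE : IsSpectralMeasure A E) (x : A.domain) :
    Integrable (fun t : ℝ => t) (E.scalarMeasure (x : 𝓗)) := by
  have h := (hE.mem_domain_iff x).1 x.2
  refine Integrable.mono' (g := fun t => 1 + t ^ 2) ?_ (by fun_prop) ?_
  · refine (integrable_const _).add ⟨by fun_prop, ?_⟩
    rwa [hasFiniteIntegral_iff_ofReal (Filter.Eventually.of_forall fun t => sq_nonneg t)]
  · refine Filter.Eventually.of_forall fun t => ?_
    rw [Real.norm_eq_abs]
    nlinarith [sq_abs t, sq_nonneg (|t| - 1)]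

theorem proj_mem_domain (hE : IsSpectralMeasure A E) (hB : MeasurableSet B) {x : 𝓗}
    (hx : x ∈ A.domain) : E.proj B x ∈ A.domain := by
  rw [hE.mem_domain_iff] at hx ⊢
  rw [E.scalarMeasure_proj hB]
  exact (lintegral_mono' Measure.restrict_le_self le_rfl).trans_lt hx

theorem proj_mem_domain_of_bounded (hE : IsSpectralMeasure A E) (hB : MeasurableSet B) {r : ℝ}
    (hr : ∀ t ∈ B, |t| ≤ r) (x : 𝓗) : E.proj B x ∈ A.domain := by
  rw [hE.mem_domain_iff, E.scalarMeasure_proj hB]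
  refine lt_of_le_of_lt (setLIntegral_mono' (g := fun _ => ENNReal.ofReal (r ^ 2)) hB
    fun t ht => ?_) ?_
  · refine ENNReal.ofReal_le_ofReal ?_
    rw [← sq_abs t]
    exact pow_le_pow_left₀ (abs_nonneg _) (hr t ht) 2
  · rw [lintegral_const]
    exact ENNReal.mul_lt_top ENNReal.ofReal_lt_top (measure_lt_top _ _)

/-- The scalar measures of `a` and `b` add up, so the cross terms in the form at `a + b` cancel:
`⟨a, A b⟩ + ⟨b, A a⟩ = 0`. Replacing `b` by `i b` gives the difference as well. -/
theorem inner_eq_zero (hE : IsSpectralMeasure A E) (hB : MeasurableSet B) (a b : A.domain)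
    (ha : E.proj B (a : 𝓗) = a) (hb : E.proj B (b : 𝓗) = 0) :
    inner ℂ (b : 𝓗) (A a) = 0 := by
  have key : ∀ b : A.domain, E.proj B (b : 𝓗) = 0 →
      inner ℂ (a : 𝓗) (A b) + inner ℂ (b : 𝓗) (A a) = 0 := by
    intro b hb
    have h := hE.inner_apply (a + b)
    rw [Submodule.coe_add, E.scalarMeasure_add hB ha hb,
      integral_add_measure (hE.integrable_id a) (hE.integrable_id b), Complex.ofReal_add,
      ← hE.inner_apply, ← hE.inner_apply, A.map_add, inner_add_left, inner_add_right,
      inner_add_right] at h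
    linear_combination h
  have h1 := key b hb
  have h2 := key (Complex.I • b) (by rw [Submodule.coe_smul, map_smul, hb, smul_zero])
  rw [A.map_smul, inner_smul_right, Submodule.coe_smul, inner_smul_left, Complex.conj_I] at h2
  have h3 : Complex.I * (inner ℂ (a : 𝓗) (A b) - inner ℂ (b : 𝓗) (A a)) = 0 := by
    linear_combination h2
  have h4 := (mul_eq_zero.1 h3).resolve_left Complex.I_ne_zero
  linear_combination (h1 - h4) / 2

theorem abs_form_le (hE : IsSpectralMeasure A E) (hB : MeasurableSet B) {a δ : ℝ}
    (hδ : ∀ t ∈ B, |t - a| ≤ δ) (v : A.domain) (hv : E.proj B (v : 𝓗) = v) :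
    |(inner ℂ (v : 𝓗) (A v)).re - a * ‖(v : 𝓗)‖ ^ 2| ≤ δ * ‖(v : 𝓗)‖ ^ 2 := by
  have h1 : (inner ℂ (v : 𝓗) (A v)).re - a * ‖(v : 𝓗)‖ ^ 2 =
      ∫ t, (t - a) ∂(E.scalarMeasure (v : 𝓗)) := by
    rw [integral_sub (hE.integrable_id v) (integrable_const _), hE.inner_apply,
      Complex.ofReal_re, integral_const, E.scalarMeasure_real_univ, smul_eq_mul, mul_comm a]
  have h2 : ∀ᵐ t ∂(E.scalarMeasure (v : 𝓗)), ‖t - a‖ ≤ δ := by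
    have h0 : E.scalarMeasure (v : 𝓗) Bᶜ = 0 := by
      rw [E.scalarMeasure_eq_zero_iff hB.compl, E.proj_compl hB, hv, sub_self]
    filter_upwards [compl_mem_ae_iff.2 h0] with t ht
    rw [compl_compl] at ht
    exact hδ t ht
  rw [h1, ← E.scalarMeasure_real_univ (v : 𝓗)]
  exact norm_integral_le_of_norm_le_const h2

/-- `A - a` is bounded by `δ` on the range of `E(B)`, if `B ⊆ [a - δ, a + δ]`. -/
theorem norm_sub_smul_le (hA : IsSelfAdjoint A) (hE : IsSpectralMeasure A E)
    (hB : MeasurableSet B) {a δ : ℝ} (hδ0 : 0 < δ) (hδ : ∀ t ∈ B, |t - a| ≤ δ) (w : A.domain)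
    (hw : E.proj B (w : 𝓗) = w) : ‖A w - (a : ℂ) • (w : 𝓗)‖ ≤ δ * ‖(w : 𝓗)‖ := by
  set y := A w - (a : ℂ) • (w : 𝓗) with hy
  have hQ : ∀ v : A.domain, (inner ℂ (v : 𝓗) (A v - (a : ℂ) • (v : 𝓗))).re =
      (inner ℂ (v : 𝓗) (A v)).re - a * ‖(v : 𝓗)‖ ^ 2 := by
    intro v
    rw [inner_sub_right, Complex.sub_re, inner_smul_right, inner_self_eq_norm_sq_to_K]
    simp [← Complex.ofReal_pow]
  -- Only the component `v₁ = E(B) v` pairs with `y`. Polarize the form bound at `v₁ ± w` and apply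
  -- the parallelogram law.
  have hdom : ∀ v : A.domain, 2 * (inner ℂ (v : 𝓗) y).re ≤
      δ * (‖(v : 𝓗)‖ ^ 2 + ‖(w : 𝓗)‖ ^ 2) := by
    intro v
    let v₁ : A.domain := ⟨E.proj B v, hE.proj_mem_domain hB v.2⟩
    have hv₁ : E.proj B (v₁ : 𝓗) = v₁ := E.proj_proj_self hB _
    have hv₂ : E.proj B ((v - v₁ : A.domain) : 𝓗) = 0 := by
      rw [Submodule.coe_sub, map_sub, hv₁, sub_self]
    have e1 : inner ℂ ((v - v₁ : A.domain) : 𝓗) y = 0 := by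
      rw [hy, inner_sub_right, hE.inner_eq_zero hB w (v - v₁) hw hv₂, inner_smul_right, ← hw,
        ← E.inner_proj hB, hv₂, inner_zero_left, mul_zero, sub_zero]
    have e2 : inner ℂ (v : 𝓗) y = inner ℂ (v₁ : 𝓗) y := by
      rw [Submodule.coe_sub, inner_sub_left, sub_eq_zero] at e1
      exact e1
    have b1 := (abs_le.1 (hE.abs_form_le hB hδ (v₁ + w)
      (by rw [Submodule.coe_add, map_add, hv₁, hw]))).2
    have b2 := (abs_le.1 (hE.abs_form_le hB hδ (v₁ - w)
      (by rw [Submodule.coe_sub, map_sub, hv₁, hw]))).1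
    have par := parallelogram_law_with_norm ℂ (v₁ : 𝓗) (w : 𝓗)
    have hn := E.norm_proj_le hB (v : 𝓗)
    have hn2 : ‖(v₁ : 𝓗)‖ ^ 2 ≤ ‖(v : 𝓗)‖ ^ 2 := pow_le_pow_left₀ (norm_nonneg _) hn 2
    rw [← hQ] at b1 b2
    have e3 : (inner ℂ ((v₁ + w : A.domain) : 𝓗)
          (A (v₁ + w) - (a : ℂ) • ((v₁ + w : A.domain) : 𝓗))).re -
        (inner ℂ ((v₁ - w : A.domain) : 𝓗)
          (A (v₁ - w) - (a : ℂ) • ((v₁ - w : A.domain) : 𝓗))).re =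
        4 * (inner ℂ (v₁ : 𝓗) y).re := by
      have e4 : inner ℂ (w : 𝓗) (A v₁ - (a : ℂ) • (v₁ : 𝓗)) =
          (starRingEnd ℂ) (inner ℂ (v₁ : 𝓗) y) := by
        rw [inner_conj_symm, hy, inner_sub_left, inner_sub_right, inner_apply_comm hA,
          inner_smul_left, inner_smul_right, Complex.conj_ofReal]
      have e5 : A (v₁ + w) - (a : ℂ) • ((v₁ + w : A.domain) : 𝓗) =
          (A v₁ - (a : ℂ) • (v₁ : 𝓗)) + y := by
        rw [A.map_add, Submodule.coe_add, smul_add, hy]; abel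
      have e6 : A (v₁ - w) - (a : ℂ) • ((v₁ - w : A.domain) : 𝓗) =
          (A v₁ - (a : ℂ) • (v₁ : 𝓗)) - y := by
        rw [A.map_sub, Submodule.coe_sub, smul_sub, hy]; abel
      rw [e5, e6, Submodule.coe_add, Submodule.coe_sub]
      generalize A v₁ - (a : ℂ) • (v₁ : 𝓗) = y₁ at e4
      simp only [inner_add_left, inner_add_right, inner_sub_left, inner_sub_right, e4,
        Complex.add_re, Complex.sub_re, Complex.conj_re]
      ring
    rw [Submodule.coe_add] at b1
    rw [Submodule.coe_sub] at b2
    rw [Submodule.coe_add, Submodule.coe_sub] at e3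
    rw [e2]
    nlinarith
  have hall : ∀ v : 𝓗, 2 * (inner ℂ v y).re ≤ δ * (‖v‖ ^ 2 + ‖(w : 𝓗)‖ ^ 2) := by
    intro v
    refine hA.dense_domain.induction (P := fun v => 2 * (inner ℂ v y).re ≤
      δ * (‖v‖ ^ 2 + ‖(w : 𝓗)‖ ^ 2)) (fun v hv => hdom ⟨v, hv⟩) ?_ v
    exact isClosed_le (by fun_prop) (by fun_prop)
  -- The test vector `δ⁻¹ y` turns the inequality into `‖y‖² ≤ δ² ‖w‖²`.
  have h := hall (((δ⁻¹ : ℝ) : ℂ) • y)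
  rw [inner_smul_left, Complex.conj_ofReal, inner_self_eq_norm_sq_to_K, norm_smul,
    Complex.norm_real, Real.norm_of_nonneg (by positivity)] at h
  have h' : 2 * (δ⁻¹ * ‖y‖ ^ 2) ≤ δ * ((δ⁻¹ * ‖y‖) ^ 2 + ‖(w : 𝓗)‖ ^ 2) := by
    refine le_trans (le_of_eq ?_) h
    simp [← Complex.ofReal_pow]
  have h2 : ‖y‖ ^ 2 ≤ (δ * ‖(w : 𝓗)‖) ^ 2 := by
    have e : δ * ((δ⁻¹ * ‖y‖) ^ 2 + ‖(w : 𝓗)‖ ^ 2) = δ⁻¹ * ‖y‖ ^ 2 + δ * ‖(w : 𝓗)‖ ^ 2 := by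
      field_simp
    rw [e] at h'
    have h3 : δ⁻¹ * ‖y‖ ^ 2 ≤ δ * ‖(w : 𝓗)‖ ^ 2 := by linarith
    rw [inv_mul_le_iff₀ hδ0] at h3
    linarith
  exact (sq_le_sq₀ (norm_nonneg _) (by positivity)).1 h2

/-- The part `w - w₁` of `R u` outside the range of `E(B)` is orthogonal to `(A - z)(w - w₁) = u -
(A - z) w₁`, so it vanishes by `im_inner_sub_smul`. -/
theorem proj_resolvent (hA : IsSelfAdjoint A) (hE : IsSpectralMeasure A E)
    (hB : MeasurableSet B) {z : ℂ} (hz : z.im ≠ 0) {R : 𝓗 →L[ℂ] 𝓗} (hR : IsResolventAt A z R)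
    {u : 𝓗} (hu : E.proj B u = u) : E.proj B (R u) = R u := by
  let w : A.domain := ⟨R u, hR.mem_domain u⟩
  let w₁ : A.domain := ⟨E.proj B w, hE.proj_mem_domain hB w.2⟩
  have hw₁ : E.proj B (w₁ : 𝓗) = w₁ := E.proj_proj_self hB _
  have hw₂ : E.proj B ((w - w₁ : A.domain) : 𝓗) = 0 := by
    rw [Submodule.coe_sub, map_sub, hw₁, sub_self]
  have hort : ∀ v : 𝓗, E.proj B v = v → inner ℂ ((w - w₁ : A.domain) : 𝓗) v = 0 := by
    intro v hv
    rw [← hv, ← E.inner_proj hB, hw₂, inner_zero_left]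
  have h1 : A w - z • (w : 𝓗) = u := hR.right_inv u
  have h2 : A (w - w₁) - z • ((w - w₁ : A.domain) : 𝓗) = u - (A w₁ - z • (w₁ : 𝓗)) := by
    rw [A.map_sub, Submodule.coe_sub, smul_sub, ← h1]; abel
  have h3 := im_inner_sub_smul hA z (w - w₁)
  rw [h2, inner_sub_right, inner_sub_right, hort u hu, hE.inner_eq_zero hB w₁ (w - w₁) hw₁ hw₂,
    inner_smul_right, hort w₁ hw₁] at h3
  simp only [mul_zero, sub_zero, Complex.zero_im] at h3
  have h4 : ‖((w - w₁ : A.domain) : 𝓗)‖ ^ 2 = 0 := by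
    rcases mul_eq_zero.1 (neg_eq_zero.1 h3.symm) with h | h
    · exact absurd h hz
    · exact h
  have h5 := norm_eq_zero.1 (pow_eq_zero_iff two_ne_zero |>.1 h4)
  rw [Submodule.coe_sub, sub_eq_zero] at h5
  exact h5.symm

theorem norm_inv_sub_le {z : ℂ} (hz : z.im ≠ 0) {a t δ : ℝ} (h : |t - a| ≤ δ) :
    ‖((t : ℂ) - z)⁻¹ - ((a : ℂ) - z)⁻¹‖ ≤ δ / |z.im| ^ 2 := by
  have him : ∀ s : ℝ, |z.im| ≤ ‖(s : ℂ) - z‖ := fun s => by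
    have := Complex.abs_im_le_norm ((s : ℂ) - z)
    simpa using this
  have hz' : 0 < |z.im| := abs_pos.2 hz
  have hne : ∀ s : ℝ, (s : ℂ) - z ≠ 0 := fun s =>
    norm_pos_iff.1 (hz'.trans_le (him s))
  rw [inv_sub_inv (hne t) (hne a), norm_div, norm_mul]
  have e : ‖(a : ℂ) - z - (t - z)‖ = |t - a| := by
    rw [sub_sub_sub_cancel_right, ← Complex.ofReal_sub, Complex.norm_real, Real.norm_eq_abs,
      abs_sub_comm]
  rw [e, sq]
  have hδ : 0 ≤ δ := (abs_nonneg _).trans h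
  have := him t
  have := him a
  gcongr

theorem integrable_inv_sub {z : ℂ} (hz : z.im ≠ 0) (μ : Measure ℝ) [IsFiniteMeasure μ] :
    Integrable (fun t : ℝ => ((t : ℂ) - z)⁻¹) μ := by
  refine Integrable.mono' (integrable_const (|z.im|⁻¹)) (by fun_prop)
    (Filter.Eventually.of_forall fun t => ?_)
  rw [norm_inv]
  have := Complex.abs_im_le_norm ((t : ℂ) - z)
  have hz' : 0 < |z.im| := abs_pos.2 hz
  gcongr
  simpa using this

/-- On the range of `E(B)` the operator `A`, and on `B` the variable `t`, differ from `a` by at most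
`δ`. Both quantities are compared with `(a - z)⁻¹ ‖E(B) x‖²`, which accounts for the factor `2`. -/
theorem norm_inner_resolvent_proj_sub_le (hA : IsSelfAdjoint A) (hE : IsSpectralMeasure A E)
    (hB : MeasurableSet B) {a δ : ℝ} (hδ0 : 0 < δ) (hδ : ∀ t ∈ B, |t - a| ≤ δ) {z : ℂ}
    (hz : z.im ≠ 0) {R : 𝓗 →L[ℂ] 𝓗} (hR : IsResolventAt A z R) (x : 𝓗) :
    ‖inner ℂ x (R (E.proj B x)) - ∫ t in B, ((t : ℂ) - z)⁻¹ ∂(E.scalarMeasure x)‖ ≤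
      2 * (δ / |z.im| ^ 2) * (E.scalarMeasure x).real B := by
  set u := E.proj B x with hu
  have huu : E.proj B u = u := E.proj_proj_self hB x
  have hz' : 0 < |z.im| := abs_pos.2 hz
  have ha : |z.im| ≤ ‖(a : ℂ) - z‖ := by
    have := Complex.abs_im_le_norm ((a : ℂ) - z)
    simpa using this
  have hne : (a : ℂ) - z ≠ 0 := norm_pos_iff.1 (hz'.trans_le ha)
  have hw := hE.proj_resolvent hA hB hz hR huu
  have h1 := hE.norm_sub_smul_le hA hB hδ0 hδ ⟨R u, hR.mem_domain u⟩ hw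
  rw [hR.apply_eq] at h1
  have h2 : ‖R u - ((a : ℂ) - z)⁻¹ • u‖ ≤ δ / |z.im| ^ 2 * ‖u‖ := by
    have e : R u - ((a : ℂ) - z)⁻¹ • u =
        -(((a : ℂ) - z)⁻¹ • (u + z • R u - (a : ℂ) • R u)) := by
      have : u + z • R u - (a : ℂ) • R u = u - ((a : ℂ) - z) • R u := by rw [sub_smul]; abel
      rw [this, smul_sub, inv_smul_smul₀ hne]; abel
    have h3 := hR.norm_le hA u
    rw [e, norm_neg, norm_smul, norm_inv]
    calc ‖(a : ℂ) - z‖⁻¹ * ‖u + z • R u - (a : ℂ) • R u‖ ≤ |z.im|⁻¹ * (δ * (|z.im|⁻¹ * ‖u‖)) := by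
          refine mul_le_mul (inv_anti₀ hz' ha) (h1.trans ?_) (norm_nonneg _) (by positivity)
          refine mul_le_mul_of_nonneg_left ?_ hδ0.le
          rw [le_inv_mul_iff₀ hz']
          exact h3
      _ = δ / |z.im| ^ 2 * ‖u‖ := by field_simp
  have h4 : inner ℂ x (R u) = inner ℂ u (R u) := by rw [← hw, ← E.inner_proj hB]; rw [hw]
  have h5 : ‖inner ℂ x (R u) - ((a : ℂ) - z)⁻¹ * (‖u‖ ^ 2 : ℝ)‖ ≤ δ / |z.im| ^ 2 * ‖u‖ ^ 2 := by
    have e : inner ℂ x (R u) - ((a : ℂ) - z)⁻¹ * (‖u‖ ^ 2 : ℝ) =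
        inner ℂ u (R u - ((a : ℂ) - z)⁻¹ • u) := by
      rw [h4, inner_sub_right, inner_smul_right, inner_self_eq_norm_sq_to_K]
      simp
    rw [e]
    refine (norm_inner_le_norm _ _).trans ?_
    calc ‖u‖ * ‖R u - ((a : ℂ) - z)⁻¹ • u‖ ≤ ‖u‖ * (δ / |z.im| ^ 2 * ‖u‖) := by gcongr
      _ = _ := by ring
  have hreal : (E.scalarMeasure x).real B = ‖u‖ ^ 2 := E.scalarMeasure_real hB x
  have h6 : ‖(∫ t in B, ((t : ℂ) - z)⁻¹ ∂(E.scalarMeasure x)) -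
      ((a : ℂ) - z)⁻¹ * (‖u‖ ^ 2 : ℝ)‖ ≤ δ / |z.im| ^ 2 * ‖u‖ ^ 2 := by
    have e : (∫ t in B, ((t : ℂ) - z)⁻¹ ∂(E.scalarMeasure x)) - ((a : ℂ) - z)⁻¹ * (‖u‖ ^ 2 : ℝ) =
        ∫ t in B, (((t : ℂ) - z)⁻¹ - ((a : ℂ) - z)⁻¹) ∂(E.scalarMeasure x) := by
      rw [integral_sub (integrable_inv_sub hz _) (integrable_const _), setIntegral_const, hreal,
        Complex.real_smul, mul_comm]
    rw [e, ← hreal]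
    exact norm_setIntegral_le_of_norm_le_const (measure_lt_top _ _)
      fun t ht => norm_inv_sub_le hz (hδ t ht)
  rw [hreal]
  calc _ = ‖(inner ℂ x (R u) - ((a : ℂ) - z)⁻¹ * (‖u‖ ^ 2 : ℝ)) -
        ((∫ t in B, ((t : ℂ) - z)⁻¹ ∂(E.scalarMeasure x)) -
          ((a : ℂ) - z)⁻¹ * (‖u‖ ^ 2 : ℝ))‖ := by congr 1; ring
    _ ≤ _ := (norm_sub_le _ _).trans (by linarith)

/-- The resolvent is the Stieltjes transform of the spectral measure. -/
theorem inner_resolvent (hA : IsSelfAdjoint A) (hE : IsSpectralMeasure A E) {z : ℂ}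
    (hz : z.im ≠ 0) {R : 𝓗 →L[ℂ] 𝓗} (hR : IsResolventAt A z R) (x : 𝓗) :
    inner ℂ x (R x) = ∫ t : ℝ, ((t : ℂ) - z)⁻¹ ∂(E.scalarMeasure x) := by
  have hz' : 0 < |z.im| := abs_pos.2 hz
  have main : ∀ δ : ℝ, 0 < δ →
      ‖inner ℂ x (R x) - ∫ t : ℝ, ((t : ℂ) - z)⁻¹ ∂(E.scalarMeasure x)‖ ≤
        2 * (δ / |z.im| ^ 2) * ‖x‖ ^ 2 := by
    intro δ hδ
    -- Cut `ℝ` into intervals of length `δ`; the errors sum to a multiple of `δ` because the masses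
    -- sum to `‖x‖²`.
    let e : ℕ ≃ ℤ := Equiv.intEquivNat.symm
    let B : ℕ → Set ℝ := fun n => Set.Ioc (e n • δ) ((e n + 1) • δ)
    have hBm : ∀ n, MeasurableSet (B n) := fun n => measurableSet_Ioc
    have hBd : Pairwise fun m n => Disjoint (B m) (B n) := fun m n hmn =>
      Set.pairwise_disjoint_Ioc_zsmul δ (e.injective.ne hmn)
    have hBU : ⋃ n, B n = Set.univ := by
      rw [← iUnion_Ioc_zsmul hδ]
      exact e.surjective.iUnion_comp fun k : ℤ => Set.Ioc (k • δ) ((k + 1) • δ)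
    have hBδ : ∀ n, ∀ t ∈ B n, |t - e n • δ| ≤ δ := fun n t ht => by
      obtain ⟨h1, h2⟩ := ht
      rw [add_smul, one_smul] at h2
      rw [abs_le]
      constructor <;> linarith
    have s1 : HasSum (fun n => inner ℂ x (R (E.proj (B n) x))) (inner ℂ x (R x)) := by
      have := (E.hasSum_iUnion B hBm hBd x).mapL ((innerSL ℂ x).comp R)
      rwa [hBU, E.univ] at this
    have s2 : HasSum (fun n => ∫ t in B n, ((t : ℂ) - z)⁻¹ ∂(E.scalarMeasure x))
        (∫ t : ℝ, ((t : ℂ) - z)⁻¹ ∂(E.scalarMeasure x)) := by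
      have := hasSum_integral_iUnion hBm hBd
        (integrable_inv_sub hz (E.scalarMeasure x)).integrableOn
      rwa [hBU, setIntegral_univ] at this
    have s3 : HasSum (fun n => 2 * (δ / |z.im| ^ 2) * (E.scalarMeasure x).real (B n))
        (2 * (δ / |z.im| ^ 2) * ‖x‖ ^ 2) := by
      refine HasSum.mul_left _ ?_
      rw [← E.scalarMeasure_real_univ x, ← hBU]
      simpa using hasSum_integral_iUnion hBm hBd
        (integrable_const (μ := E.scalarMeasure x) (1 : ℝ)).integrableOn
    rw [← (s1.sub s2).tsum_eq]
    exact tsum_of_norm_bounded s3 fun n =>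
      hE.norm_inner_resolvent_proj_sub_le hA (hBm n) hδ (hBδ n) hz hR x
  refine eq_of_norm_sub_le_zero (le_of_forall_pos_le_add fun ε hε => ?_)
  rw [zero_add]
  refine (main (ε * |z.im| ^ 2 / (2 * (‖x‖ ^ 2 + 1))) (by positivity)).trans ?_
  have : 2 * (ε * |z.im| ^ 2 / (2 * (‖x‖ ^ 2 + 1)) / |z.im| ^ 2) * ‖x‖ ^ 2 =
      ε * (‖x‖ ^ 2 / (‖x‖ ^ 2 + 1)) := by
    field_simp
  rw [this]
  refine mul_le_of_le_one_right hε.le ?_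
  rw [div_le_one (by positivity)]
  linarith

end IsSpectralMeasure

end SpectralMeasure

/-! ### Inversion of the Stieltjes transform -/

section Stieltjes

open Filter

/-- The Stieltjes transform of a measure on `ℝ`. -/
def stieltjes (μ : Measure ℝ) (z : ℂ) : ℂ := ∫ t : ℝ, ((t : ℂ) - z)⁻¹ ∂μ

/-- The points `s + 1/m + i/m²`, `m = n + 1`, approaching `s`. -/
def approachPoint (n : ℕ) (s : ℝ) : ℂ :=
  ⟨s + ((n : ℝ) + 1)⁻¹, (((n : ℝ) + 1) ^ 2)⁻¹⟩

theorem approachPoint_im_ne_zero (n : ℕ) (s : ℝ) : (approachPoint n s).im ≠ 0 := by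
  have : (0 : ℝ) < (((n : ℝ) + 1) ^ 2)⁻¹ := by positivity
  exact this.ne'

theorem im_inv_sub_approachPoint (n : ℕ) (s t : ℝ) :
    (((t : ℂ) - approachPoint n s)⁻¹).im =
      ((n : ℝ) + 1) ^ 2 / (1 + ((s - t) * ((n : ℝ) + 1) ^ 2 + ((n : ℝ) + 1)) ^ 2) := by
  have hm : (0 : ℝ) < (n : ℝ) + 1 := by positivity
  rw [Complex.inv_im, Complex.normSq_apply]
  simp only [approachPoint, Complex.sub_im, Complex.sub_re, Complex.ofReal_re, Complex.ofReal_im,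
    zero_sub, neg_neg]
  have hpos : (0 : ℝ) < (((n : ℝ) + 1) ^ 2)⁻¹ := by positivity
  have hden : 0 < (t - (s + ((n : ℝ) + 1)⁻¹)) * (t - (s + ((n : ℝ) + 1)⁻¹)) +
      -(((n : ℝ) + 1) ^ 2)⁻¹ * -(((n : ℝ) + 1) ^ 2)⁻¹ := by
    nlinarith [mul_self_nonneg (t - (s + ((n : ℝ) + 1)⁻¹))]
  rw [div_eq_div_iff hden.ne' (by positivity)]
  field_simp
  ring

theorem continuous_stieltjes_approachPoint (μ : Measure ℝ) [IsFiniteMeasure μ] (n : ℕ) :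
    Continuous fun s => stieltjes μ (approachPoint n s) := by
  have hap : Continuous (approachPoint n) := by
    change Continuous fun s : ℝ => Complex.equivRealProdCLM.symm
      (s + ((n : ℝ) + 1)⁻¹, (((n : ℝ) + 1) ^ 2)⁻¹)
    fun_prop
  have him : ∀ s t : ℝ, |(approachPoint n s).im| ≤ ‖(t : ℂ) - approachPoint n s‖ := fun s t => by
    have := Complex.abs_im_le_norm ((t : ℂ) - approachPoint n s)
    simpa using this
  have hpos : ∀ s, 0 < |(approachPoint n s).im| := fun s =>
    abs_pos.2 (approachPoint_im_ne_zero n s)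
  refine continuous_of_dominated (bound := fun _ => |(approachPoint n 0).im|⁻¹)
    (fun s => by fun_prop) (fun s => Eventually.of_forall fun t => ?_) (integrable_const _)
    (Eventually.of_forall fun t => ?_)
  · rw [norm_inv]
    exact inv_anti₀ (hpos 0) (him s t)
  · exact (continuous_const.sub hap).inv₀ fun s => norm_pos_iff.1 ((hpos s).trans_le (him s t))

theorem integral_im_inv_sub_approachPoint (n : ℕ) (a b t : ℝ) :
    ∫ s in a..b, (((t : ℂ) - approachPoint n s)⁻¹).im =
      Real.arctan ((b - t) * ((n : ℝ) + 1) ^ 2 + ((n : ℝ) + 1)) -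
        Real.arctan ((a - t) * ((n : ℝ) + 1) ^ 2 + ((n : ℝ) + 1)) := by
  simp_rw [im_inv_sub_approachPoint]
  refine intervalIntegral.integral_eq_sub_of_hasDerivAt
    (f := fun s => Real.arctan ((s - t) * ((n : ℝ) + 1) ^ 2 + ((n : ℝ) + 1))) (fun s _ => ?_) ?_
  · have h := ((((hasDerivAt_id s).sub_const t).mul_const (((n : ℝ) + 1) ^ 2)).add_const
      ((n : ℝ) + 1)).arctan
    refine h.congr_deriv ?_
    rw [one_mul, one_div, div_eq_inv_mul]
    rfl
  · refine Continuous.intervalIntegrable ?_ _ _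
    refine continuous_const.div (by fun_prop) fun s => ?_
    positivity

/-- The case `c = 0` explains the path `s + 1/m + i/m²`: the horizontal shift dominates the height,
so the limit is `π/2` instead of the value `0` of a vertical approach. An atom at an endpoint is
therefore counted fully or not at all, and the inversion yields exactly `Ioc a b`. -/
theorem tendsto_arctan_approach (c : ℝ) :
    Tendsto (fun n : ℕ => Real.arctan (c * ((n : ℝ) + 1) ^ 2 + ((n : ℝ) + 1))) atTop
      (nhds (if 0 ≤ c then Real.pi / 2 else -(Real.pi / 2))) := by
  have hm : Tendsto (fun n : ℕ => (n : ℝ) + 1) atTop atTop :=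
    tendsto_atTop_add_const_right _ _ tendsto_natCast_atTop_atTop
  split_ifs with hc
  · refine (Real.tendsto_arctan_atTop.mono_right nhdsWithin_le_nhds).comp
      (tendsto_atTop_mono (fun n => ?_) hm)
    have : 0 ≤ c * ((n : ℝ) + 1) ^ 2 := by positivity
    linarith
  · refine (Real.tendsto_arctan_atBot.mono_right nhdsWithin_le_nhds).comp ?_
    have h1 : Tendsto (fun n : ℕ => c * ((n : ℝ) + 1) + 1) atTop atBot :=
      tendsto_atBot_add_const_right _ _ (hm.const_mul_atTop_of_neg (not_le.1 hc))
    refine (hm.atTop_mul_atBot₀ h1).congr fun n => ?_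
    ring

/-- Stieltjes inversion formula. -/
theorem tendsto_stieltjes (μ : Measure ℝ) [IsFiniteMeasure μ] {a b : ℝ} (hab : a ≤ b) :
    Tendsto (fun n : ℕ => Real.pi⁻¹ * ∫ s in a..b, (stieltjes μ (approachPoint n s)).im) atTop
      (nhds (μ.real (Set.Ioc a b))) := by
  let g : ℕ → ℝ → ℝ := fun n t =>
    Real.arctan ((b - t) * ((n : ℝ) + 1) ^ 2 + ((n : ℝ) + 1)) -
      Real.arctan ((a - t) * ((n : ℝ) + 1) ^ 2 + ((n : ℝ) + 1))
  have hF : ∀ n : ℕ, ∫ s in a..b, (stieltjes μ (approachPoint n s)).im = ∫ t, g n t ∂μ := by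
    intro n
    have h1 : ∀ s, (stieltjes μ (approachPoint n s)).im =
        ∫ t : ℝ, (((t : ℂ) - approachPoint n s)⁻¹).im ∂μ := fun s =>
      (integral_im (𝕜 := ℂ)
        (IsSpectralMeasure.integrable_inv_sub (approachPoint_im_ne_zero n s) μ)).symm
    simp_rw [h1]
    rw [intervalIntegral_integral_swap]
    · refine integral_congr_ae (Eventually.of_forall fun t => ?_)
      exact integral_im_inv_sub_approachPoint n a b t
    · have : IsFiniteMeasure (volume.restrict (Set.uIoc a b)) :=
        ⟨by rw [Measure.restrict_apply_univ, Set.uIoc]; exact measure_Ioc_lt_top⟩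
      simp_rw [Function.uncurry_def, im_inv_sub_approachPoint]
      refine Integrable.mono' (integrable_const (((n : ℝ) + 1) ^ 2))
        (Measurable.aestronglyMeasurable (by fun_prop)) (Eventually.of_forall fun p => ?_)
      rw [Real.norm_of_nonneg (by positivity)]
      refine div_le_self (by positivity) ?_
      nlinarith [sq_nonneg ((p.1 - p.2) * ((n : ℝ) + 1) ^ 2 + ((n : ℝ) + 1))]
  simp_rw [hF]
  have hlim : Tendsto (fun n => ∫ t, g n t ∂μ) atTop
      (nhds (∫ t, (Set.Ioc a b).indicator (fun _ => Real.pi) t ∂μ)) := by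
    refine tendsto_integral_of_dominated_convergence (fun _ => Real.pi)
      (fun n => Measurable.aestronglyMeasurable (by fun_prop)) (integrable_const _)
      (fun n => Eventually.of_forall fun t => ?_) (Eventually.of_forall fun t => ?_)
    · have h1 := Real.arctan_lt_pi_div_two ((b - t) * ((n : ℝ) + 1) ^ 2 + ((n : ℝ) + 1))
      have h2 := Real.neg_pi_div_two_lt_arctan ((b - t) * ((n : ℝ) + 1) ^ 2 + ((n : ℝ) + 1))
      have h3 := Real.arctan_lt_pi_div_two ((a - t) * ((n : ℝ) + 1) ^ 2 + ((n : ℝ) + 1))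
      have h4 := Real.neg_pi_div_two_lt_arctan ((a - t) * ((n : ℝ) + 1) ^ 2 + ((n : ℝ) + 1))
      rw [Real.norm_eq_abs, abs_le]
      constructor <;> simp only [g] <;> linarith
    · have h := (tendsto_arctan_approach (b - t)).sub (tendsto_arctan_approach (a - t))
      have e : (Set.Ioc a b).indicator (fun _ => Real.pi) t =
          (if 0 ≤ b - t then Real.pi / 2 else -(Real.pi / 2)) -
            (if 0 ≤ a - t then Real.pi / 2 else -(Real.pi / 2)) := by
        simp only [Set.indicator, Set.mem_Ioc, sub_nonneg]
        rcases le_or_gt t a with h1 | h1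
        · have h2 : ¬ (a < t) := not_lt.2 h1
          simp [h2, h1, h1.trans hab]
        · have h2 : ¬ (t ≤ a) := not_le.2 h1
          by_cases h3 : t ≤ b
          · simp [h1, h2, h3]
          · simp [h1, h2, h3]
      rw [e]
      exact h
  have h := hlim.const_mul Real.pi⁻¹
  rw [integral_indicator_const _ measurableSet_Ioc, smul_eq_mul, mul_comm (μ.real _),
    inv_mul_cancel_left₀ Real.pi_ne_zero] at h
  exact h

theorem measure_ext_of_stieltjes {μ ν : Measure ℝ} [IsFiniteMeasure μ] [IsFiniteMeasure ν]
    (h : ∀ z : ℂ, z.im ≠ 0 → stieltjes μ z = stieltjes ν z) : μ = ν := by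
  refine Measure.ext_of_Ioc μ ν fun a b hab => ?_
  have h1 := tendsto_stieltjes μ hab.le
  have h2 := tendsto_stieltjes ν hab.le
  simp_rw [h _ (approachPoint_im_ne_zero _ _)] at h1
  exact (measureReal_eq_measureReal_iff (measure_ne_top _ _) (measure_ne_top _ _)).1
    (tendsto_nhds_unique h1 h2)

/-- Inversion exhibits the mass of `Ioc a b` as a limit of integrals over `s` of functions
continuous in `s` and measurable in `ω`, hence jointly measurable. The half-open intervals form a
generating π-system. -/
theorem measurable_measure_of_stieltjes {Ω : Type*} [MeasurableSpace Ω] {μ : Ω → Measure ℝ}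
    [∀ ω, IsFiniteMeasure (μ ω)] (huniv : Measurable fun ω => μ ω Set.univ)
    (h : ∀ z : ℂ, z.im ≠ 0 → Measurable fun ω => stieltjes (μ ω) z) : Measurable μ := by
  have hgen : (inferInstance : MeasurableSpace ℝ) =
      .generateFrom {S : Set ℝ | ∃ l u, l < u ∧ Set.Ioc l u = S} := by
    rw [← borel_eq_generateFrom_Ioc ℝ]
    exact BorelSpace.measurable_eq
  refine Measurable.measure_of_isPiSystem hgen (isPiSystem_Ioc id id) ?_ huniv
  rintro _ ⟨a, b, hab, rfl⟩
  have hreal : Measurable fun ω => (μ ω).real (Set.Ioc a b) := by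
    refine measurable_of_tendsto_metrizable (f := fun (n : ℕ) ω =>
      Real.pi⁻¹ * ∫ s in a..b, (stieltjes (μ ω) (approachPoint n s)).im) (fun n => ?_)
      (tendsto_pi_nhds.2 fun ω => tendsto_stieltjes (μ ω) hab.le)
    refine Measurable.const_mul ?_ _
    simp_rw [intervalIntegral.integral_of_le hab.le]
    refine StronglyMeasurable.measurable (StronglyMeasurable.integral_prod_left
      (f := fun (s : ℝ) (ω : Ω) => (stieltjes (μ ω) (approachPoint n s)).im) ?_)
    exact stronglyMeasurable_uncurry_of_continuous_of_stronglyMeasurable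
      (fun ω => Complex.continuous_im.comp (continuous_stieltjes_approachPoint (μ ω) n))
      fun s => (Complex.measurable_im.comp
        (h _ (approachPoint_im_ne_zero n s))).stronglyMeasurable
  have e : (fun ω => μ ω (Set.Ioc a b)) = fun ω => ENNReal.ofReal ((μ ω).real (Set.Ioc a b)) :=
    funext fun ω => (ofReal_measureReal (measure_ne_top _ _)).symm
  rw [e]
  exact hreal.ennreal_ofReal

end Stieltjes

/-! ### Independence of the choice, covariance and measurability of spectral projections -/

section Uniqueness

variable {𝓗 : Type*} [NormedAddCommGroup 𝓗] [InnerProductSpace ℂ 𝓗] [CompleteSpace 𝓗]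
  {A : 𝓗 →ₗ.[ℂ] 𝓗}

/-- The spectral measure of a self-adjoint operator used in `spectralProj`. -/
theorem exists_spectralProj_eq (hA : IsSelfAdjoint A) :
    ∃ E : PVMeasure 𝓗, IsSpectralMeasure A E ∧ ∀ B, spectralProj A B = E.proj B := by
  have h := exists_isSpectralMeasure hA
  exact ⟨h.choose, h.choose_spec, fun B => by rw [spectralProj, dif_pos h]⟩

/-- The right-hand side does not involve `E`, so the scalar measures depend on `A` alone. -/
theorem IsSpectralMeasure.stieltjes_eq (hA : IsSelfAdjoint A) {E : PVMeasure 𝓗}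
    (hE : IsSpectralMeasure A E) {z : ℂ} (hz : z.im ≠ 0) (x : 𝓗) :
    stieltjes (E.scalarMeasure x) z = inner ℂ x (resolventOp A z x) := by
  obtain ⟨R, hR⟩ := exists_isResolventAt hA hz
  rw [hR.resolventOp_eq, hE.inner_resolvent hA hz hR, stieltjes]

omit [CompleteSpace 𝓗] in
theorem isResolventAt_unitaryConj {U : 𝓗 ≃ₗᵢ[ℂ] 𝓗} {z : ℂ} {R : 𝓗 →L[ℂ] 𝓗}
    (h : IsResolventAt A z R) :
    IsResolventAt (unitaryConj U A) z
      ((U : 𝓗 →L[ℂ] 𝓗) ∘L R ∘L (U.symm : 𝓗 →L[ℂ] 𝓗)) := by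
  have hmem : ∀ x, U.symm (U (R (U.symm x))) ∈ A.domain := fun x => by
    rw [U.symm_apply_apply]
    exact h.mem_domain _
  refine ⟨hmem, fun x => ?_, fun x => ?_⟩
  · have e : (⟨U.symm (U (R (U.symm x))), hmem x⟩ : A.domain) =
        ⟨R (U.symm x), h.mem_domain _⟩ := Subtype.ext (U.symm_apply_apply _)
    change U (A ⟨U.symm (U (R (U.symm x))), hmem x⟩) - z • U (R (U.symm x)) = x
    rw [e, ← map_smul, ← map_sub, h.right_inv, U.apply_symm_apply]
  · change U (R (U.symm (U (A ⟨U.symm x, x.2⟩) - z • (x : 𝓗)))) = x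
    rw [map_sub, U.symm_apply_apply, map_smul, h.left_inv ⟨U.symm x, x.2⟩]
    exact U.apply_symm_apply _

theorem scalarMeasure_unitaryConj (hA : IsSelfAdjoint A) {U : 𝓗 ≃ₗᵢ[ℂ] 𝓗}
    (hA' : IsSelfAdjoint (unitaryConj U A)) {E E' : PVMeasure 𝓗} (hE : IsSpectralMeasure A E)
    (hE' : IsSpectralMeasure (unitaryConj U A) E') (x : 𝓗) :
    E'.scalarMeasure x = E.scalarMeasure (U.symm x) := by
  refine measure_ext_of_stieltjes fun z hz => ?_
  rw [hE.stieltjes_eq hA hz, hE'.stieltjes_eq hA' hz]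
  obtain ⟨R, hR⟩ := exists_isResolventAt hA hz
  rw [hR.resolventOp_eq, (isResolventAt_unitaryConj hR).resolventOp_eq]
  change inner ℂ x (U (R (U.symm x))) = _
  conv_lhs => rw [← U.apply_symm_apply x, U.inner_map_map, U.symm_apply_apply]

theorem spectralProj_unitaryConj_eq_zero_iff (hA : IsSelfAdjoint A) {U : 𝓗 ≃ₗᵢ[ℂ] 𝓗}
    (hA' : IsSelfAdjoint (unitaryConj U A)) {B : Set ℝ} (hB : MeasurableSet B) (x : 𝓗) :
    spectralProj (unitaryConj U A) B x = 0 ↔ spectralProj A B (U.symm x) = 0 := by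
  obtain ⟨E, hE, h⟩ := exists_spectralProj_eq hA
  obtain ⟨E', hE', h'⟩ := exists_spectralProj_eq hA'
  rw [h, h', ← E.scalarMeasure_eq_zero_iff hB, ← E'.scalarMeasure_eq_zero_iff hB,
    scalarMeasure_unitaryConj hA hA' hE hE']

theorem inner_spectralProj_self (hA : IsSelfAdjoint A) {B : Set ℝ} (hB : MeasurableSet B)
    (x : 𝓗) : inner ℂ x (spectralProj A B x) = ((‖spectralProj A B x‖ ^ 2 : ℝ) : ℂ) := by
  obtain ⟨E, hE, h⟩ := exists_spectralProj_eq hA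
  rw [h, E.inner_proj_self hB]

theorem inner_spectralProj_comm (hA : IsSelfAdjoint A) {B : Set ℝ} (hB : MeasurableSet B)
    (x y : 𝓗) : inner ℂ (spectralProj A B x) y = inner ℂ x (spectralProj A B y) := by
  obtain ⟨E, hE, h⟩ := exists_spectralProj_eq hA
  rw [h, E.inner_proj hB]

/-- Measurability is what allows a zero lower integral, hence `ν(B) = 0`, to be read as an almost
sure statement. -/
theorem measurable_norm_spectralProj {Ω : Type*} [MeasurableSpace Ω] {H : Ω → 𝓗 →ₗ.[ℂ] 𝓗}
    (hH : IsMeasurableFamily H) {B : Set ℝ} (hB : MeasurableSet B) (x : 𝓗) :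
    Measurable fun ω => ENNReal.ofReal (‖spectralProj (H ω) B x‖ ^ 2) := by
  choose E hE h using fun ω => exists_spectralProj_eq (hH.isSelfAdjoint ω)
  have hm : Measurable fun ω => (E ω).scalarMeasure x := by
    refine measurable_measure_of_stieltjes ?_ fun z hz => ?_
    · have : (fun ω => (E ω).scalarMeasure x Set.univ) = fun _ => ENNReal.ofReal (‖x‖ ^ 2) := by
        ext ω
        rw [(E ω).scalarMeasure_apply MeasurableSet.univ, (E ω).univ, one_apply_eq_self]
      rw [this]
      exact measurable_const
    · rw [funext fun ω => (hE ω).stieltjes_eq (hH.isSelfAdjoint ω) hz x]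
      exact hH.measurable_resolvent z hz x x
  have := (Measure.measurable_measure.1 hm) B hB
  simp_rw [(fun ω => (E ω).scalarMeasure_apply hB x), ← h] at this
  exact this

end Uniqueness

/-! ### Reducing subspaces -/

section Reducing

variable {𝓗 : Type*} [NormedAddCommGroup 𝓗] [InnerProductSpace ℂ 𝓗] [CompleteSpace 𝓗]
  {A : 𝓗 →ₗ.[ℂ] 𝓗} {M : ClosedSubmodule ℂ 𝓗}

/-- Same mechanism as `IsSpectralMeasure.proj_resolvent`: the component of `R x` orthogonal to `M`
is orthogonal to its image under `A - z`. -/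
theorem Reduces.resolvent_mem (hA : IsSelfAdjoint A) (hM : Reduces M A) {z : ℂ} (hz : z.im ≠ 0)
    {R : 𝓗 →L[ℂ] 𝓗} (hR : IsResolventAt A z R) {x : 𝓗} (hx : x ∈ M.toSubmodule) :
    R x ∈ M.toSubmodule := by
  let w : A.domain := ⟨R x, hR.mem_domain x⟩
  obtain ⟨hw, hAw⟩ := hM w w.2
  let w₁ : A.domain := ⟨M.toSubmodule.starProjection w, hw⟩
  have hw₁ : (w₁ : 𝓗) ∈ M.toSubmodule := Submodule.starProjection_apply_mem _ _
  have hort : ∀ v ∈ M.toSubmodule, inner ℂ ((w - w₁ : A.domain) : 𝓗) v = 0 := fun v hv => by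
    rw [Submodule.coe_sub]
    exact M.toSubmodule.starProjection_inner_eq_zero w v hv
  have h1 : A w - z • (w : 𝓗) = x := hR.right_inv x
  have h2 : A (w - w₁) - z • ((w - w₁ : A.domain) : 𝓗) = x - (A w₁ - z • (w₁ : 𝓗)) := by
    rw [A.map_sub, Submodule.coe_sub, smul_sub, ← h1]; abel
  have h3 := im_inner_sub_smul hA z (w - w₁)
  rw [h2, inner_sub_right, inner_sub_right, hort x hx, hort _ hAw, inner_smul_right,
    hort _ hw₁] at h3
  simp only [mul_zero, sub_zero, Complex.zero_im] at h3
  have h4 : ‖((w - w₁ : A.domain) : 𝓗)‖ ^ 2 = 0 := by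
    rcases mul_eq_zero.1 (neg_eq_zero.1 h3.symm) with h | h
    · exact absurd h hz
    · exact h
  have h5 := norm_eq_zero.1 (pow_eq_zero_iff two_ne_zero |>.1 h4)
  rw [Submodule.coe_sub, sub_eq_zero] at h5
  change (w : 𝓗) ∈ M.toSubmodule
  rw [h5]
  exact hw₁

theorem Reduces.isResolventAt_restrict (hM : Reduces M A) {z : ℂ} {R : 𝓗 →L[ℂ] 𝓗}
    (hR : IsResolventAt A z R) (hRM : ∀ x : M.toSubmodule, R x ∈ M.toSubmodule) :
    IsResolventAt (restrict A M hM) z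
      ((R ∘L M.toSubmodule.subtypeL).codRestrict M.toSubmodule hRM) :=
  ⟨fun x => hR.mem_domain x, fun x => Subtype.ext (hR.right_inv x),
    fun x => Subtype.ext (hR.left_inv ⟨x, x.2⟩)⟩

/-- For `v ⊥ M` the cross terms `⟨v, R x⟩` and `⟨x, R v⟩` vanish, so by Stieltjes uniqueness the
scalar measures of `x` and `v` add. Expanding `‖E(B)(x + v)‖²` then gives `Re ⟨v, E(B) x⟩ = 0`. -/
theorem Reduces.proj_mem (hA : IsSelfAdjoint A) (hM : Reduces M A) {E : PVMeasure 𝓗}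
    (hE : IsSpectralMeasure A E) {B : Set ℝ} (hB : MeasurableSet B) {x : 𝓗}
    (hx : x ∈ M.toSubmodule) : E.proj B x ∈ M.toSubmodule := by
  have hadd : ∀ v ∈ M.toSubmoduleᗮ, E.scalarMeasure (x + v) =
      E.scalarMeasure x + E.scalarMeasure v := by
    intro v hv
    refine measure_ext_of_stieltjes fun z hz => ?_
    have e : stieltjes (E.scalarMeasure x + E.scalarMeasure v) z =
        stieltjes (E.scalarMeasure x) z + stieltjes (E.scalarMeasure v) z :=
      integral_add_measure (IsSpectralMeasure.integrable_inv_sub hz _)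
        (IsSpectralMeasure.integrable_inv_sub hz _)
    obtain ⟨R, hR⟩ := exists_isResolventAt hA hz
    have hz' : ((starRingEnd ℂ) z).im ≠ 0 := by simpa using hz
    obtain ⟨R', hR'⟩ := exists_isResolventAt hA hz'
    rw [e, hE.stieltjes_eq hA hz, hE.stieltjes_eq hA hz, hE.stieltjes_eq hA hz, hR.resolventOp_eq,
      map_add, inner_add_left, inner_add_right, inner_add_right]
    have h1 : inner ℂ v (R x) = 0 :=
      Submodule.inner_left_of_mem_orthogonal (hM.resolvent_mem hA hz hR hx) hv
    have h2 : inner ℂ x (R v) = 0 := by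
      rw [← ContinuousLinearMap.adjoint_inner_left, ← ContinuousLinearMap.star_eq_adjoint,
        hR.adjoint_eq hA hR']
      exact Submodule.inner_right_of_mem_orthogonal (hM.resolvent_mem hA hz' hR' hx) hv
    rw [h1, h2]
    ring
  have hre : ∀ v ∈ M.toSubmoduleᗮ, (inner ℂ v (E.proj B x)).re = 0 := by
    intro v hv
    have h : (E.scalarMeasure (x + v)).real B =
        (E.scalarMeasure x).real B + (E.scalarMeasure v).real B := by
      rw [hadd v hv, measureReal_add_apply]
    rw [E.scalarMeasure_real hB, E.scalarMeasure_real hB, E.scalarMeasure_real hB, map_add,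
      norm_add_sq (𝕜 := ℂ)] at h
    have h1 : RCLike.re (inner ℂ (E.proj B x) (E.proj B v)) = 0 := by linarith
    rw [E.inner_proj hB, E.proj_proj_self hB, ← E.inner_proj hB, inner_re_symm] at h1
    exact h1
  have hzero : ∀ v ∈ M.toSubmoduleᗮ, inner ℂ v (E.proj B x) = 0 := by
    intro v hv
    -- This multiple of `v` makes the real part equal to `|⟨v, E(B) x⟩|²`.
    have h := hre (inner ℂ v (E.proj B x) • v) (Submodule.smul_mem _ _ hv)
    rw [inner_smul_left, Complex.conj_mul', ← Complex.ofReal_pow, Complex.ofReal_re] at h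
    exact norm_eq_zero.1 (pow_eq_zero_iff two_ne_zero |>.1 h)
  rw [← Submodule.orthogonal_orthogonal M.toSubmodule, Submodule.mem_orthogonal]
  exact hzero

/-- The spectral measure of `A` restricted to `M` vanishes near points of the resolvent set of
`A|_M`. -/
theorem Reduces.exists_proj_eq_zero (hA : IsSelfAdjoint A) (hM : Reduces M A) {E : PVMeasure 𝓗}
    (hE : IsSpectralMeasure A E) {t : ℝ} (ht : (t : ℂ) ∉ spec (restrict A M hM)) :
    ∃ δ > 0, ∀ x ∈ M.toSubmodule, E.proj (Metric.ball t δ) x = 0 := by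
  simp only [spec, Set.mem_ofPred_eq, not_not] at ht
  obtain ⟨K, hK⟩ := ht
  have hδ : 0 < (2 * (‖K‖ + 1))⁻¹ := by positivity
  -- The radius gives `‖K‖ δ ≤ 1/2`. For `y` in the range of `E(ball t δ)` and in `M`, `y = K (A -
  -- t) y` with `‖(A - t) y‖ ≤ δ ‖y‖`, which forces `y = 0`.
  refine ⟨(2 * (‖K‖ + 1))⁻¹, hδ, fun x hx => ?_⟩
  set δ := (2 * (‖K‖ + 1))⁻¹ with hδ_def
  have hB : MeasurableSet (Metric.ball t δ) := measurableSet_ball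
  have hBδ : ∀ s ∈ Metric.ball t δ, |s - t| ≤ δ := fun s hs => by
    rw [Metric.mem_ball, Real.dist_eq] at hs
    exact hs.le
  have hdom : E.proj (Metric.ball t δ) x ∈ A.domain := by
    refine hE.proj_mem_domain_of_bounded hB (r := |t| + δ) (fun s hs => ?_) x
    have h1 := hBδ s hs
    have h2 := abs_add_le (s - t) t
    rw [sub_add_cancel] at h2
    linarith
  have hmem := hM.proj_mem hA hE hB hx
  set y := E.proj (Metric.ball t δ) x with hy
  have h1 := hE.norm_sub_smul_le hA hB hδ hBδ ⟨y, hdom⟩ (E.proj_proj_self hB x)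
  have h2 := hK.left_inv ⟨⟨y, hmem⟩, hdom⟩
  have h3 : ‖y‖ ≤ ‖K‖ * ‖A ⟨y, hdom⟩ - (t : ℂ) • y‖ := by
    have := K.le_opNorm (restrict A M hM ⟨⟨y, hmem⟩, hdom⟩ - (t : ℂ) • ⟨y, hmem⟩)
    rw [h2] at this
    exact this
  have h4 : ‖y‖ ≤ ‖K‖ * (δ * ‖y‖) :=
    h3.trans (mul_le_mul_of_nonneg_left h1 (norm_nonneg _))
  have h5 : ‖K‖ * δ ≤ 1 / 2 := by
    rw [hδ_def, mul_inv, mul_comm (2 : ℝ)⁻¹, ← mul_assoc]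
    have : ‖K‖ * (‖K‖ + 1)⁻¹ ≤ 1 := by
      rw [mul_inv_le_iff₀ (by positivity)]; linarith
    linarith
  have h6 : ‖y‖ ≤ 1 / 2 * ‖y‖ := by
    calc ‖y‖ ≤ (‖K‖ * δ) * ‖y‖ := by rw [mul_assoc]; exact h4
      _ ≤ _ := by gcongr
  exact norm_eq_zero.1 (le_antisymm (by linarith) (norm_nonneg y))

/-- `Im z ‖R x‖² = ∫ Im z / |t - z|² dμ_x ≤ Im z ε⁻² ‖x‖²`. The factor `Im z` cancels, so the bound
does not degenerate near the real axis. -/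
theorem norm_resolvent_le_of_null (hA : IsSelfAdjoint A) {E : PVMeasure 𝓗}
    (hE : IsSpectralMeasure A E) {z : ℂ} (hz : 0 < z.im) {R : 𝓗 →L[ℂ] 𝓗}
    (hR : IsResolventAt A z R) {ε : ℝ} (hε : 0 < ε) {x : 𝓗}
    (hx : E.scalarMeasure x (Metric.ball z.re ε) = 0) : ‖R x‖ ≤ ε⁻¹ * ‖x‖ := by
  have h1 := hR.im_inner hA x
  rw [hE.inner_resolvent hA hz.ne' hR] at h1
  have h2 : (∫ t : ℝ, ((t : ℂ) - z)⁻¹ ∂(E.scalarMeasure x)).im =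
      ∫ t : ℝ, (((t : ℂ) - z)⁻¹).im ∂(E.scalarMeasure x) :=
    (integral_im (𝕜 := ℂ) (IsSpectralMeasure.integrable_inv_sub hz.ne' _)).symm
  have h3 : ∀ᵐ t : ℝ ∂(E.scalarMeasure x), ‖(((t : ℂ) - z)⁻¹).im‖ ≤ z.im * (ε⁻¹) ^ 2 := by
    filter_upwards [compl_mem_ae_iff.2 hx] with t ht
    rw [Set.mem_compl_iff, Metric.mem_ball, Real.dist_eq, not_lt] at ht
    have hsq : ε ^ 2 ≤ (t - z.re) ^ 2 := by
      rw [← sq_abs (t - z.re)]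
      exact pow_le_pow_left₀ hε.le ht 2
    have hN : ε ^ 2 ≤ Complex.normSq ((t : ℂ) - z) := by
      rw [Complex.normSq_apply]
      simp only [Complex.sub_re, Complex.sub_im, Complex.ofReal_re, Complex.ofReal_im]
      nlinarith [mul_self_nonneg (0 - z.im)]
    rw [Complex.inv_im, Complex.sub_im, Complex.ofReal_im, zero_sub, neg_neg, norm_div,
      Real.norm_of_nonneg hz.le, Real.norm_of_nonneg (Complex.normSq_nonneg _), inv_pow,
      div_eq_mul_inv]
    gcongr
  have h4 := norm_integral_le_of_norm_le_const h3
  rw [← h2, h1, E.scalarMeasure_real_univ, Real.norm_of_nonneg (by positivity), mul_assoc] at h4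
  have h5 := le_of_mul_le_mul_left h4 hz
  rw [← mul_pow] at h5
  exact (sq_le_sq₀ (norm_nonneg _) (by positivity)).1 h5

theorem isClosed_of_spec_eq {𝓚 : Type*} [NormedAddCommGroup 𝓚] [InnerProductSpace ℂ 𝓚]
    [CompleteSpace 𝓚] {A : 𝓚 →ₗ.[ℂ] 𝓚} {S : Set ℝ} (hS : spec A = Complex.ofReal '' S) :
    IsClosed S := by
  have h : S = Complex.ofReal ⁻¹' (spec A) := by
    rw [hS, Set.preimage_image_eq _ Complex.ofReal_injective]
  rw [h]
  exact (isClosed_spec A).preimage Complex.continuous_ofReal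

instance (M : ClosedSubmodule ℂ 𝓗) : CompleteSpace M.toSubmodule :=
  M.isClosed'.completeSpace_coe

/-- If the spectral projection of `A` on `S ∩ I` vanishes, then the spectrum `S` of a part of `A`
does not meet the interior of `I`. -/
theorem Reduces.inter_interior_eq_empty (hA : IsSelfAdjoint A) (hM : Reduces M A) {S I : Set ℝ}
    (hI : MeasurableSet I) (hS : spec (restrict A M hM) = Complex.ofReal '' S)
    (h0 : ∀ x, spectralProj A (S ∩ I) x = 0) : S ∩ interior I = ∅ := by
  obtain ⟨E, hE, hEA⟩ := exists_spectralProj_eq hA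
  have hSm : MeasurableSet S := (isClosed_of_spec_eq hS).measurableSet
  rw [Set.eq_empty_iff_forall_notMem]
  rintro l ⟨hlS, hlI⟩
  obtain ⟨ε, hε, hball⟩ := Metric.isOpen_iff.1 isOpen_interior l hlI
  have hnull : ∀ x ∈ M.toSubmodule, E.scalarMeasure x (Metric.ball l ε) = 0 := by
    intro x hx
    have h1 : E.scalarMeasure x (S ∩ I) = 0 := by
      rw [E.scalarMeasure_eq_zero_iff (hSm.inter hI), ← hEA]
      exact h0 x
    have h2 : E.scalarMeasure x Sᶜ = 0 := by
      refine measure_null_of_locally_null _ fun t ht => ?_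
      have ht' : (t : ℂ) ∉ spec (restrict A M hM) := by
        rw [hS]
        rintro ⟨s, hs, hst⟩
        exact ht (Complex.ofReal_injective hst ▸ hs)
      obtain ⟨δ, hδ, h⟩ := hM.exists_proj_eq_zero hA hE ht'
      exact ⟨_, mem_nhdsWithin_of_mem_nhds (Metric.ball_mem_nhds t hδ),
        (E.scalarMeasure_eq_zero_iff measurableSet_ball x).2 (h x hx)⟩
    refine measure_mono_null (fun t ht => ?_) (measure_union_null h1 h2)
    by_cases htS : t ∈ S
    · exact Or.inl ⟨htS, interior_subset (hball ht)⟩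
    · exact Or.inr htS
  have hl : (l : ℂ) ∈ spec (restrict A M hM) := hS ▸ ⟨l, hlS, rfl⟩
  refine hl ?_
  -- The resolvent on `M` has norm at most `1/ε` here and `l` is at distance `ε/2`: the product
  -- `1/2` lets the Neumann series converge.
  let z : ℂ := ⟨l, ε / 2⟩
  have hz : 0 < z.im := by change 0 < ε / 2; positivity
  obtain ⟨R, hR⟩ := exists_isResolventAt hA hz.ne'
  have hRM : ∀ x : M.toSubmodule, R x ∈ M.toSubmodule := fun x =>
    hM.resolvent_mem hA hz.ne' hR x.2
  refine (hM.isResolventAt_restrict hR hRM).exists_of_norm_lt ?_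
  have hn : ‖(R ∘L M.toSubmodule.subtypeL).codRestrict M.toSubmodule hRM‖ ≤ ε⁻¹ :=
    ContinuousLinearMap.opNorm_le_bound _ (by positivity) fun x =>
      norm_resolvent_le_of_null hA hE hz hR hε (hnull x x.2)
  have hd : ‖(l : ℂ) - z‖ = ε / 2 := by
    have e : (l : ℂ) - z = ((-(ε / 2) : ℝ) : ℂ) * Complex.I := by
      apply Complex.ext <;> simp [z]
    rw [e, norm_mul, Complex.norm_I, mul_one, Complex.norm_real, norm_neg,
      Real.norm_of_nonneg (by positivity)]
  rw [hd]
  calc ε / 2 * _ ≤ ε / 2 * ε⁻¹ := by gcongr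
    _ < 1 := by
      have : ε / 2 * ε⁻¹ = 1 / 2 := by field_simp
      rw [this]; norm_num

end Reducing

/-! ### Stationary families -/

section Stationary

variable {𝓗 : Type*} [NormedAddCommGroup 𝓗] [InnerProductSpace ℂ 𝓗] [CompleteSpace 𝓗]
  {Ω : Type*} [MeasurableSpace Ω] {d : ℕ} {P : Measure Ω} {T : (Fin d → ℤ) → Ω → Ω}
  {U : (Fin d → ℤ) → 𝓗 ≃ₗᵢ[ℂ] 𝓗} {H : Ω → 𝓗 →ₗ.[ℂ] 𝓗} {B : Set ℝ}

theorem ae_spectralProj_eq_zero_of_lintegral (hH : IsMeasurableFamily H) (hB : MeasurableSet B)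
    {x : 𝓗} (h : ∫⁻ ω, ENNReal.ofReal (‖spectralProj (H ω) B x‖ ^ 2) ∂P = 0) :
    ∀ᵐ ω ∂P, spectralProj (H ω) B x = 0 := by
  rw [lintegral_eq_zero_iff (measurable_norm_spectralProj hH hB x)] at h
  filter_upwards [h] with ω hω
  have h1 : ‖spectralProj (H ω) B x‖ ^ 2 = 0 :=
    le_antisymm (ENNReal.ofReal_eq_zero.1 hω) (sq_nonneg _)
  exact norm_eq_zero.1 (pow_eq_zero_iff two_ne_zero |>.1 h1)

/-- Since `T i` preserves `P`, the hypothesis also holds at `T i ω` almost surely; covariance moves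
it back to `ω`. Countability of `ℤ^d` gives a single exceptional null set. -/
theorem IsStationaryFamily.ae_spectralProj_shift_eq_zero (hH : IsStationaryFamily P T U H)
    (hB : MeasurableSet B) {x : 𝓗} (h : ∀ᵐ ω ∂P, spectralProj (H ω) B x = 0) :
    ∀ᵐ ω ∂P, ∀ i, spectralProj (H ω) B ((U i).symm x) = 0 := by
  rw [ae_all_iff]
  intro i
  filter_upwards [(hH.measurePreserving i).quasiMeasurePreserving.ae h] with ω hω
  have hs := hH.isMeasurableFamily.isSelfAdjoint
  have h1 := hs (T i ω)
  rw [hH.covariant] at hω h1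
  exact (spectralProj_unitaryConj_eq_zero_iff (hs ω) h1 hB x).1 hω

/-- A positive spectrum does not meet the interior of `I` if almost all spectral projections on
`S ∩ I` vanish. -/
theorem IsPositiveSpectrum.inter_interior_eq_empty {S I : Set ℝ} (hS : IsPositiveSpectrum P H S)
    (hH : IsMeasurableFamily H) (hI : MeasurableSet I)
    (h : MeasurableSet (S ∩ I) → ∀ᵐ ω ∂P, ∀ x, spectralProj (H ω) (S ∩ I) x = 0) :
    S ∩ interior I = ∅ := by
  obtain ⟨M, hM, Ω₀, -, hpos, hspec⟩ := hS
  -- One realization suffices to see that `S` is closed, as a spectrum, and hence Borel.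
  obtain ⟨ω₁, hω₁⟩ := nonempty_of_measure_ne_zero hpos.ne'
  have hSm : MeasurableSet S := (isClosed_of_spec_eq (hspec ω₁ hω₁)).measurableSet
  obtain ⟨ω, hω, hω'⟩ : ∃ ω ∈ Ω₀, ∀ x, spectralProj (H ω) (S ∩ I) x = 0 := by
    by_contra! hcon
    refine hpos.ne' (measure_mono_null (fun ω hω => ?_) (ae_iff.1 (h (hSm.inter hI))))
    obtain ⟨x, hx⟩ := hcon ω hω
    exact fun hall => hx (hall x)
  exact (hM ω).inter_interior_eq_empty (hH.isSelfAdjoint ω) hI (hspec ω hω) hω'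

end Stationary

/-- Distinct members are at distance `√2`, so balls of radius `1/2` around them are disjoint open
sets. -/
theorem _root_.Orthonormal.countable {𝓗 ι : Type*} [NormedAddCommGroup 𝓗]
    [InnerProductSpace ℂ 𝓗] [SecondCountableTopology 𝓗] {v : ι → 𝓗} (hv : Orthonormal ℂ v) :
    Countable ι := by
  refine Pairwise.countable_of_isOpen_disjoint (s := fun i => Metric.ball (v i) (1 / 2))
    (fun i j hij => Metric.ball_disjoint_ball ?_) (fun i => Metric.isOpen_ball)
    fun i => ⟨v i, Metric.mem_ball_self (by norm_num)⟩
  have h := norm_sub_sq (𝕜 := ℂ) (v i) (v j)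
  rw [hv.inner_eq_zero hij, hv.norm_eq_one, hv.norm_eq_one, map_zero] at h
  rw [dist_eq_norm]
  nlinarith [norm_nonneg (v i - v j)]

/-! ### The discrete model: translates of `δ₀` are total -/

section Discrete

variable {d : ℕ}

theorem discreteShift_single (i : Fin d → ℤ) :
    (discreteShift i).symm (lp.single 2 0 1 : DiscreteSpace d) = lp.single 2 (-i) 1 := by
  ext x
  change (lp.single 2 0 1 : DiscreteSpace d) (x - -i) = _
  rw [lp.coeFn_single, lp.coeFn_single, Pi.single_apply, Pi.single_apply]
  simp only [sub_eq_zero]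

theorem eq_zero_of_single_eq_zero (Q : DiscreteSpace d →L[ℂ] DiscreteSpace d)
    (h : ∀ i, Q (lp.single 2 i 1) = 0) (f : DiscreteSpace d) : Q f = 0 := by
  have hs := (lp.hasSum_single (p := 2) (by norm_num) f).mapL Q
  have h0 : ∀ i, Q (lp.single 2 i (f i)) = 0 := fun i => by
    have : (lp.single 2 i (f i) : DiscreteSpace d) = f i • lp.single 2 i 1 := by
      rw [← lp.single_smul, smul_eq_mul, mul_one]
    rw [this, map_smul, h, smul_zero]
  simp only [h0] at hs
  exact hs.unique hasSum_zero

theorem discrete_inter_interior_eq_empty {Ω : Type*} [MeasurableSpace Ω] {P : Measure Ω}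
    {T : (Fin d → ℤ) → Ω → Ω} {I S : Set ℝ} (hI : MeasurableSet I)
    {H : Ω → DiscreteSpace d →ₗ.[ℂ] DiscreteSpace d}
    (hH : IsStationaryFamily P T discreteShift H) (hS : IsPositiveSpectrum P H S)
    (h0 : discreteDOS P H (S ∩ I) = 0) : S ∩ interior I = ∅ := by
  have hm := hH.isMeasurableFamily
  refine hS.inter_interior_eq_empty hm hI fun hB => ?_
  simp only [discreteDOS, inner_spectralProj_self (hm.isSelfAdjoint _) hB, Complex.ofReal_re] at h0
  have h1 := ae_spectralProj_eq_zero_of_lintegral hm hB h0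
  filter_upwards [hH.ae_spectralProj_shift_eq_zero hB h1] with ω hω
  refine eq_zero_of_single_eq_zero _ fun i => ?_
  have := hω (-i)
  rwa [discreteShift_single, neg_neg] at this

end Discrete

/-! ### The continuous model: translates of the unit cube cover space -/

section Continuous

variable {d : ℕ}

theorem inner_cubeMul_self (f : ContinuousSpace d) :
    inner ℂ (cubeMul d f) f = ((‖cubeMul d f‖ ^ 2 : ℝ) : ℂ) := by
  have h : inner ℂ (cubeMul d f) f = inner ℂ (cubeMul d f) (cubeMul d f) := by
    rw [L2.inner_def, L2.inner_def]
    refine integral_congr_ae ?_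
    filter_upwards [cubeMul_coeFn f] with x hx
    rw [hx]
    by_cases hxc : x ∈ unitCube d <;> simp [hxc]
  rw [h, inner_self_eq_norm_sq_to_K]
  exact (Complex.ofReal_pow _ _).symm

theorem inner_cubeMul_comm (f g : ContinuousSpace d) :
    inner ℂ (cubeMul d f) g = inner ℂ f (cubeMul d g) := by
  rw [L2.inner_def, L2.inner_def]
  refine integral_congr_ae ?_
  filter_upwards [cubeMul_coeFn f, cubeMul_coeFn g] with x hx hx'
  rw [hx, hx']
  by_cases hxc : x ∈ unitCube d <;> simp [hxc]

theorem exists_mem_unitCube_sub (x : Fin d → ℝ) :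
    ∃ i : Fin d → ℤ, (x - fun k => (i k : ℝ)) ∈ unitCube d := by
  refine ⟨fun k => round (x k), ?_⟩
  rw [unitCube, Set.mem_Icc]
  constructor <;> intro k <;> have := abs_le.1 (abs_sub_round (x k)) <;>
    simp only [Pi.sub_apply] <;> linarith

/-- Rounding coordinates puts every point in an integer translate of the cube; `f` vanishes almost
everywhere on each of these countably many translates. -/
theorem eq_zero_of_cubeMul_shift_eq_zero {f : ContinuousSpace d}
    (h : ∀ i, cubeMul d (continuousShift i f) = 0) : f = 0 := by
  refine Lp.eq_zero_iff_ae_eq_zero.2 ?_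
  have h1 : ∀ i : Fin d → ℤ, ∀ᵐ x : Fin d → ℝ, x - (fun k => (i k : ℝ)) ∈ unitCube d →
      f x = 0 := by
    intro i
    have h2 : ∀ᵐ x : Fin d → ℝ, x ∈ unitCube d → f (x - fun k => ((-i) k : ℝ)) = 0 := by
      filter_upwards [cubeMul_coeFn (continuousShift (-i) f), continuousShift_coeFn (-i) f,
        Lp.coeFn_zero ℂ 2 (volume : Measure (Fin d → ℝ))] with x e1 e2 e3 hx
      rw [h (-i), e3, Set.indicator_of_mem hx, e2] at e1
      exact e1.symm
    filter_upwards [(measurePreserving_subLattice i).quasiMeasurePreserving.ae h2] with x hx hxc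
    have := hx hxc
    have e : (subLattice i x - fun k => (((-i) k : ℤ) : ℝ)) = x := by
      ext k
      simp [subLattice]
    rwa [e] at this
  filter_upwards [ae_all_iff.2 h1] with x hx
  obtain ⟨i, hi⟩ := exists_mem_unitCube_sub x
  exact hx i hi

/-- A self-adjoint operator annihilating all translates of the range of `cubeMul` vanishes. -/
theorem eq_zero_of_cube_eq_zero {Q : ContinuousSpace d →L[ℂ] ContinuousSpace d}
    (hQ : ∀ f g, inner ℂ (Q f) g = inner ℂ f (Q g))
    (h : ∀ i f, Q ((continuousShift i).symm (cubeMul d f)) = 0) (f : ContinuousSpace d) :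
    Q f = 0 := by
  refine eq_zero_of_cubeMul_shift_eq_zero fun i => ?_
  -- With `U` the shift by `i` and `χ` the cutoff, `‖χ U Q f‖² = ⟨χ U Q f, U Q f⟩ = ⟨Q U* χ U Q f,
  -- f⟩ = 0`.
  have h1 := inner_cubeMul_self (continuousShift i (Q f))
  rw [← (continuousShift i).apply_symm_apply (cubeMul d (continuousShift i (Q f))),
    LinearIsometryEquiv.inner_map_map, ← hQ, h, inner_zero_left,
    LinearIsometryEquiv.apply_symm_apply] at h1
  have h2 : ‖cubeMul d (continuousShift i (Q f))‖ ^ 2 = 0 := Complex.ofReal_eq_zero.1 h1.symm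
  exact norm_eq_zero.1 (pow_eq_zero_iff two_ne_zero |>.1 h2)

theorem continuous_inter_interior_eq_empty {Ω : Type*} [MeasurableSpace Ω] {P : Measure Ω}
    {T : (Fin d → ℤ) → Ω → Ω} {I S : Set ℝ} (hI : MeasurableSet I)
    {H : Ω → ContinuousSpace d →ₗ.[ℂ] ContinuousSpace d}
    (hH : IsStationaryFamily P T continuousShift H) (hS : IsPositiveSpectrum P H S)
    (h0 : continuousDOS P H (S ∩ I) = 0) : S ∩ interior I = ∅ := by
  have hm := hH.isMeasurableFamily
  refine hS.inter_interior_eq_empty hm hI fun hB => ?_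
  obtain ⟨b, hb⟩ := (exists_hilbertBasis ℂ (ContinuousSpace d)).choose_spec
  have : Fact ((2 : ℝ≥0∞) ≠ ∞) := ⟨ENNReal.ofNat_ne_top⟩
  have hcount := b.orthonormal.countable
  -- The trace dominates each of its terms `‖E_ω(B) χ_Λ φ‖²`, so each has zero expectation;
  -- monotonicity of the integral suffices.
  have hzero : ∀ φ : (exists_hilbertBasis ℂ (ContinuousSpace d)).choose, ∀ᵐ ω ∂P, ∀ i,
      spectralProj (H ω) (S ∩ I) ((continuousShift i).symm (cubeMul d φ)) = 0 := by
    intro φ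
    refine hH.ae_spectralProj_shift_eq_zero hB
      (ae_spectralProj_eq_zero_of_lintegral hm hB (le_antisymm ?_ zero_le))
    rw [← h0, continuousDOS]
    refine lintegral_mono fun ω => ?_
    refine le_trans (le_of_eq ?_) (ENNReal.le_tsum φ)
    simp only [ContinuousLinearMap.comp_apply]
    rw [← inner_cubeMul_comm, inner_spectralProj_self (hm.isSelfAdjoint ω) hB, Complex.ofReal_re]
  filter_upwards [ae_all_iff.2 hzero] with ω hω
  refine eq_zero_of_cube_eq_zero (inner_spectralProj_comm (hm.isSelfAdjoint ω) hB) fun i f => ?_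
  have hs := (b.hasSum_repr f).mapL (spectralProj (H ω) (S ∩ I) ∘L
    ((continuousShift i).symm : ContinuousSpace d →L[ℂ] ContinuousSpace d) ∘L cubeMul d)
  refine hs.unique ?_
  convert hasSum_zero with φ
  rw [hb, map_smul]
  change _ • spectralProj (H ω) (S ∩ I) ((continuousShift i).symm (cubeMul d φ)) = 0
  rw [hω φ i, smul_zero]

end Continuous

end

end RandomOperator

theorem theorem3p1 (d : ℕ) {Ω : Type*} [MeasurableSpace Ω] (P : Measure Ω)
    [IsProbabilityMeasure P] (T : (Fin d → ℤ) → Ω → Ω)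
    (I : Set ℝ) (hI_closed : IsClosed I) (hI_interval : I.OrdConnected) (S : Set ℝ) :
    (∀ H : Ω → DiscreteSpace d →ₗ.[ℂ] DiscreteSpace d,
      IsStationaryFamily P T discreteShift H → IsPositiveSpectrum P H S →
      discreteDOS P H (S ∩ I) = 0 → S ∩ interior I = ∅) ∧
    (∀ H : Ω → ContinuousSpace d →ₗ.[ℂ] ContinuousSpace d,
      IsStationaryFamily P T continuousShift H → IsPositiveSpectrum P H S →
      continuousDOS P H (S ∩ I) = 0 → S ∩ interior I = ∅) :=
  ⟨fun _ hH hS h0 => discrete_inter_interior_eq_empty hI_closed.measurableSet hH hS h0,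
    fun _ hH hS h0 => continuous_inter_interior_eq_empty hI_closed.measurableSet hH hS h0⟩
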